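/- **Setting.** Let $D\ge 1$, let $\mathcal A$ be a finite alphabet, $\mathfrak A\subseteq\mathcal A^{\mathbb Z^D}$ a subshift, and write $\mathbb B(z,r)=z+[-r..r]^D$. A block on $\mathbb B(z,r)$ is *admissible* if, translated to the origin, it is the restriction to $[-r..r]^D$ of some $b\in\mathfrak A$. For $\mathbf a\in\mathcal A^{\mathbb Z^D}$ let $\mathcal F(z)\in\mathbb N\cup\{\infty\}$ be the supremum of the $r$ for which $\mathbf a_{\mathbb B(z,r)}$ is admissible, and let $\mathbb G_R(\mathbf a)=\{z:\mathcal F(z)\ge R\}$. Assume $\sup_z\mathcal F(z)=\infty$. The defect of $\mathbf a$ is *removable* if for some $r>0$ there is $\mathbf a'\in\mathfrak A$ that agrees with $\mathbf a$ on $\mathbb G_r(\mathbf a)$; otherwise it is *essential*. A *trail* is a nearest-neighbour path in $\mathbb Z^D$. For $Y\subseteq\mathbb Z^D$ let $\mathbf Y\subseteq\mathbb R^D$ be the union of the unit cubes $z+[0,1]^D$ all of whose corners lie in $Y$. A trail-connected component $Y$ of $\mathbb G_{r_0}(\mathbf a)$ is *projective* if it meets $\mathbb G_R(\mathbf a)$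 for every $R\ge r_0$. Assume that, for some $r_0$, $\mathbb G_{r_0}(\mathbf a)$ has exactly one projective component $Y$; for $r>r_0$ put $Y_r=Y\cap\mathbb G_r(\mathbf a)$. A *proper base ray* is a continuous $\omega:[0,\infty)\to\mathbf Y$ with $|\omega(t)|\to\infty$ such that, for every $r$, $\omega(t)\in\mathbf Y_r$ for all large $t$. Put $\pi_1(\mathbb G_\infty(\mathbf a),\omega)=\varprojlim_{r>r_0}\pi_1(\mathbf Y_r,\omega(t_r))$, where $\omega([t_r,\infty))\subseteq\mathbf Y_r$ and base points are changed along $\omega$. Assume that $\mathbf a$ has a *projective codimension-two defect*: $\pi_1(\mathbb G_\infty(\mathbf a),\omega')$ is nontrivial for some proper base ray $\omega'$. Let $G$ be a discrete group. A *cocycle* is a continuous $C:\mathbb Z^D\times\mathfrak A\to G$ with $C(y+z,\mathbf b)=C(y,\sigma^z\mathbf b)\,C(z,\mathbf b)$, where $(\sigma^z\mathbf b)_y=b_{y+z}$. Cocycles $C,C'$ are *cohomologous* if $C'(z,\mathbf b)=\beta(\sigma^z\mathbf b)C(z,\mathbf b)\beta(\mathbf b)^{-1}$ for some continuous $\beta:\mathfrak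 A\to G$; $H^1_{dy}(\mathfrak A,G)$ is the set of cohomology classes. A *local rule* of radius $s$ for $C$ is a function $c$ with $C(e,\mathbf b)=c(e,\mathbf b_{\mathbb B(0,s)})$ for all unit steps $e$ and all $\mathbf b\in\mathfrak A$. For a trail $\zeta=(z_0,\dots,z_N)$ in $Y_R$ with $R>s$ put $C(\zeta,\mathbf a)=c(z_N-z_{N-1},\mathbf a_{\mathbb B(z_{N-1},s)})\cdots c(z_1-z_0,\mathbf a_{\mathbb B(z_0,s)})$. A *basing* consists of a range $R>r_0$, a time $t$ with $\omega([t,\infty))\subseteq\mathbf Y_R$, a lattice point $y\in\mathbf Y_R$ and a path $\gamma$ in $\mathbf Y_R$ from $\omega(t)$ to $y$. A closed trail $\zeta$ in $Y_R$ at $y$ *represents* $x\in\pi_1(\mathbb G_\infty(\mathbf a),\omega)$ if its piecewise linear loop lies in $\mathbf Y_R$ and $\gamma\star\zeta\star\bar\gamma$ is in the class of the component of $x$ in $\pi_1(\mathbf Y_R,\omega(t))$. **Theorem.** Let $\omega$ be a proper base ray. *(Well-definedness.)* Every cocycle has a local rule of some radius. For every $R>r_0$ there is a basing of range $R$, and for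 every basing each $x\in\pi_1(\mathbb G_\infty(\mathbf a),\omega)$ is represented by a closed trail. For each $\kappa\in H^1_{dy}(\mathfrak A,G)$ there is a function $\mathrm{res}(\kappa,\cdot):\pi_1(\mathbb G_\infty(\mathbf a),\omega)\to G$, unique up to conjugation by a fixed element of $G$, such that for every $C\in\kappa$, every local rule of $C$ (of radius $s$, say) and every basing of range $R>s$ there is $g\in G$ with $C(\zeta,\mathbf a)=g\,\mathrm{res}(\kappa,x)\,g^{-1}$ for all $x$ and all closed trails $\zeta$ representing $x$. In particular, if $G$ is abelian, $\mathrm{res}(\kappa,x)=C(\zeta,\mathbf a)$ is a well-defined element of $G$. (a) If $\mathrm{res}(\kappa,x)\ne e$ for some $\kappa,x$, then the defect of $\mathbf a$ is essential, and it is a codimension-two defect: $\pi_1(\mathbb G_\infty(\mathbf a),\omega)$ is nontrivial. (b) If $G$ is abelian, then $\mathrm{res}$ is a group homomorphism in each of its two variables. More precisely, let $\mathcal Z$ be the group of cocycles under pointwise multiplication and $\mathcal B$ the subgroup of cocycles cohomologous to a homomorphism $\mathbb Z^D\to G$. There is a unique homomorphism $\mathcal Z/\mathcal B\to\mathrm{Hom}(\pi_1(\mathbb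 G_\infty(\mathbf a),\omega),G)$ whose value at the class of each cocycle $C$ is the residue function of the cohomology class of $C$. -/

import Mathlib

open SymbolicDynamics.FullShift
open scoped NNReal unitInterval

namespace CrystalDefect

/-! ## Configurations, admissible blocks, the defect field -/

/-- The lattice `ℤ^D`. -/
abbrev Lat (D : ℕ) : Type := Fin D → ℤ

/-- The box `[-r..r]^D` in `ℤ^D`. -/
def box (D r : ℕ) : Set (Lat D) := {u | ∀ i, |u i| ≤ (r : ℤ)}

/-- The block of radius `r` of the configuration `a` around the site `z`, translated to the
origin. -/
def block {D : ℕ} {A : Type*} (r : ℕ) (a : Lat D → A) (z : Lat D) : box D r → A :=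
  fun u => a (z + u)

/-- The admissible `r`-blocks of a subshift. -/
def admissible {D : ℕ} {A : Type*} [TopologicalSpace A] (𝔄 : Subshift A (Lat D)) (r : ℕ) :
    Set (box D r → A) :=
  {w | ∃ b ∈ 𝔄.carrier, block r b 0 = w}

/-- The defect field: the largest `r` for which the `r`-block of `a` around `z` is admissible. -/
noncomputable def energy {D : ℕ} {A : Type*} [TopologicalSpace A] (𝔄 : Subshift A (Lat D))
    (a : Lat D → A) (z : Lat D) : ℕ∞ :=
  ⨆ (r : ℕ) (_ : block r a z ∈ admissible 𝔄 r), (r : ℕ∞)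

/-- The slightly defective configurations: those with unbounded defect field. -/
def slightlyDefective {D : ℕ} {A : Type*} [TopologicalSpace A] (𝔄 : Subshift A (Lat D)) :
    Set (Lat D → A) :=
  {a | ⨆ z, energy 𝔄 a z = ⊤}

/-- The unflawed region of range `R` of the configuration `a`. -/
def unflawed {D : ℕ} {A : Type*} [TopologicalSpace A] (𝔄 : Subshift A (Lat D))
    (a : Lat D → A) (R : ℕ) : Set (Lat D) :=
  {z | (R : ℕ∞) ≤ energy 𝔄 a z}

/-- The defect of `a` is removable if it can be erased by changing `a` off some unflawed region. -/
def IsRemovable {D : ℕ} {A : Type*} [TopologicalSpace A] (𝔄 : Subshift A (Lat D))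
    (a : Lat D → A) : Prop :=
  ∃ r : ℕ, 0 < r ∧ ∃ a' ∈ 𝔄.carrier, ∀ z ∈ unflawed 𝔄 a r, a' z = a z

/-- A defect is essential if it is not removable. -/
def IsEssential {D : ℕ} {A : Type*} [TopologicalSpace A] (𝔄 : Subshift A (Lat D))
    (a : Lat D → A) : Prop :=
  ¬ IsRemovable 𝔄 a

/-! ## Trails, components, cubical realization -/

/-- The unit steps `(0, …, 0, ±1, 0, …, 0)`. -/
def unitSteps (D : ℕ) : Set (Lat D) := {e | ∃ i, e = Pi.single i 1 ∨ e = Pi.single i (-1)}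

/-- The nearest-neighbour graph on `ℤ^D`. Its walks are the trails. -/
def latGraph (D : ℕ) : SimpleGraph (Lat D) where
  Adj y z := z - y ∈ unitSteps D
  symm := ⟨by
    rintro y z ⟨i, h | h⟩
    · refine ⟨i, Or.inr ?_⟩
      rw [← neg_sub, h, Pi.single_neg]
    · refine ⟨i, Or.inl ?_⟩
      rw [← neg_sub, h, Pi.single_neg, neg_neg]⟩
  loopless := ⟨by
    rintro y ⟨i, h | h⟩
    · simpa using congrFun h i
    · simpa using congrFun h i⟩

/-- A trail. -/
abbrev Trail {D : ℕ} (y z : Lat D) : Type := (latGraph D).Walk y z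

/-- All vertices of the trail lie in `S`. -/
def Trail.InSet {D : ℕ} {y z : Lat D} (ζ : Trail y z) (S : Set (Lat D)) : Prop :=
  ∀ v ∈ SimpleGraph.Walk.support ζ, v ∈ S

/-- `Y` is a (trail-)connected component of `S`. -/
def IsComponent {D : ℕ} (S Y : Set (Lat D)) : Prop :=
  ∃ y ∈ S, Y = {z | ∃ ζ : Trail y z, ζ.InSet S}

/-- `Y` is a projective connected component of the unflawed region of range `r`. -/
def IsProjectiveComponent {D : ℕ} {A : Type*} [TopologicalSpace A] (𝔄 : Subshift A (Lat D))
    (a : Lat D → A) (r : ℕ) (Y : Set (Lat D)) : Prop :=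
  IsComponent (unflawed 𝔄 a r) Y ∧ ∀ R, r ≤ R → (Y ∩ unflawed 𝔄 a R).Nonempty

/-- A lattice point seen in `ℝ^D`. -/
def toReal {D : ℕ} (z : Lat D) : Fin D → ℝ := fun i => (z i : ℝ)

/-- The corners of the unit cube at `z`. -/
def corners {D : ℕ} (z : Lat D) : Set (Lat D) := {w | ∀ i, w i = z i ∨ w i = z i + 1}

/-- The unit cube `z + [0,1]^D`. -/
def cube {D : ℕ} (z : Lat D) : Set (Fin D → ℝ) := {p | ∀ i, (z i : ℝ) ≤ p i ∧ p i ≤ z i + 1}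

/-- The union of all unit cubes with all their corners in `Y`. -/
def realization {D : ℕ} (Y : Set (Lat D)) : Set (Fin D → ℝ) :=
  {p | ∃ z, corners z ⊆ Y ∧ p ∈ cube z}

theorem realization_mono {D : ℕ} {Y Y' : Set (Lat D)} (h : Y ⊆ Y') :
    realization Y ⊆ realization Y' :=
  fun _ ⟨z, hz, hp⟩ => ⟨z, hz.trans h, hp⟩

theorem unflawed_anti {D : ℕ} {A : Type*} [TopologicalSpace A] (𝔄 : Subshift A (Lat D))
    (a : Lat D → A) {r R : ℕ} (h : r ≤ R) : unflawed 𝔄 a R ⊆ unflawed 𝔄 a r :=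
  fun _ hz => le_trans (Nat.cast_le.mpr h : (r : ℕ∞) ≤ R) hz

/-- The piecewise linear path in `ℝ^D` traced out by a trail. -/
noncomputable def Trail.path {D : ℕ} {y z : Lat D} : Trail y z → Path (toReal y) (toReal z)
  | .nil => Path.refl _
  | .cons (v := v) _ p => (Path.segment (toReal y) (toReal v)).trans (Trail.path p)

/-! ## Proper base rays and the proper fundamental group -/

/-- The realization of `Y_r`, the part of `Y` lying in the unflawed region of range `r`. -/
def region {D : ℕ} {A : Type*} [TopologicalSpace A] (𝔄 : Subshift A (Lat D))
    (a : Lat D → A) (Y : Set (Lat D)) (r : ℕ) : Set (Fin D → ℝ) :=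
  realization (Y ∩ unflawed 𝔄 a r)

theorem region_anti {D : ℕ} {A : Type*} [TopologicalSpace A] (𝔄 : Subshift A (Lat D))
    (a : Lat D → A) (Y : Set (Lat D)) {r R : ℕ} (h : r ≤ R) :
    region 𝔄 a Y R ⊆ region 𝔄 a Y r :=
  realization_mono (Set.inter_subset_inter_right _ (unflawed_anti 𝔄 a h))

/-- A proper base ray: a ray in the realization of `Y` that tends to infinity and is eventually
in the realization of `Y_r`, for each `r`. The last clause provides a base point of `Y_r` on the
ray, for each `r`, and makes the identifications along the ray possible. -/
structure ProperBaseRay {D : ℕ} {A : Type*} [TopologicalSpace A] (𝔄 : Subshift A (Lat D))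
    (a : Lat D → A) (Y : Set (Lat D)) where
  toFun : ℝ≥0 → (Fin D → ℝ)
  continuous_toFun : Continuous toFun
  mem : ∀ t, toFun t ∈ realization Y
  tendsto : Filter.Tendsto (fun t => ‖toFun t‖) Filter.atTop Filter.atTop
  eventually_mem : ∀ r : ℕ, ∀ᶠ t in Filter.atTop, toFun t ∈ region 𝔄 a Y r

namespace ProperBaseRay

variable {D : ℕ} {A : Type*} [TopologicalSpace A] {𝔄 : Subshift A (Lat D)} {a : Lat D → A}
  {Y : Set (Lat D)}

/-- A range `r > r₀` together with a time `t` after which the ray stays in the realization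
of `Y_r`. -/
structure Index (ω : ProperBaseRay 𝔄 a Y) (r₀ : ℕ) where
  r : ℕ
  t : ℝ≥0
  lt : r₀ < r
  mem : ∀ u, t ≤ u → ω.toFun u ∈ region 𝔄 a Y r

variable {ω : ProperBaseRay 𝔄 a Y} {r₀ : ℕ}

/-- The point of the ray at time `u ≥ i.t`. -/
def Index.pt (i : ω.Index r₀) (u : ℝ≥0) (h : i.t ≤ u) : region 𝔄 a Y i.r :=
  ⟨ω.toFun u, i.mem u h⟩

/-- The base point on the ray. -/
def Index.base (i : ω.Index r₀) : region 𝔄 a Y i.r := i.pt i.t le_rfl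

/-- The fundamental group of the realization of `Y_r` with base point on the ray. -/
abbrev Index.group (i : ω.Index r₀) : Type :=
  FundamentalGroup (region 𝔄 a Y i.r) i.base

/-- The segment of the ray from time `i.t` to time `u`. -/
noncomputable def Index.seg (i : ω.Index r₀) (u : ℝ≥0) (h : i.t ≤ u) :
    Path i.base (i.pt u h) where
  toFun s := i.pt (i.t + unitInterval.toNNReal s * (u - i.t)) le_self_add
  continuous_toFun := by
    refine Continuous.subtype_mk (ω.continuous_toFun.comp ?_) _
    exact continuous_const.add (unitInterval.toNNReal_continuous.mul continuous_const)
  source' := by simp [Index.base]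
  target' := by simp [Index.pt, add_tsub_cancel_of_le h]

/-- For `i ≤ j`, the homomorphism induced by inclusion, followed by change of base point back
along the ray. -/
noncomputable def Index.bond (i j : ω.Index r₀) (hr : i.r ≤ j.r) (ht : i.t ≤ j.t) :
    j.group →* i.group :=
  (FundamentalGroup.fundamentalGroupMulEquivOfPath (i.seg j.t ht).symm).toMonoidHom.comp
    (FundamentalGroup.map
      ⟨Set.inclusion (region_anti 𝔄 a Y hr), continuous_inclusion (region_anti 𝔄 a Y hr)⟩ j.base)

variable (ω r₀) in
/-- The proper fundamental group: the inverse limit, over `r > r₀`, of the fundamental groups of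
the realizations of `Y_r` with base points on the ray. The limit runs over the directed set of
all pairs of a range and a sufficiently late time, so that no base points have to be selected. -/
noncomputable def properPi1 : Subgroup (∀ i : ω.Index r₀, i.group) where
  carrier := {x | ∀ (i j : ω.Index r₀) (hr : i.r ≤ j.r) (ht : i.t ≤ j.t),
    i.bond j hr ht (x j) = x i}
  one_mem' := fun i j hr ht => map_one (i.bond j hr ht)
  mul_mem' := fun {x y} hx hy i j hr ht => by
    rw [Pi.mul_apply, Pi.mul_apply, map_mul, hx i j hr ht, hy i j hr ht]
  inv_mem' := fun {x} hx i j hr ht => by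
    rw [Pi.inv_apply, Pi.inv_apply, map_inv, hx i j hr ht]

variable (ω r₀) in
/-- A range `r`, a base point on the ray, and a path `γ` in the realization of `Y_r` from it
to a lattice point `y`. -/
structure Basing where
  idx : ω.Index r₀
  y : Lat D
  mem : toReal y ∈ region 𝔄 a Y idx.r
  γ : Path idx.base ⟨toReal y, mem⟩

/-- The closed trail `ζ` in `Y_r` represents the element `x` of the proper fundamental group: its
piecewise linear path is a loop `p` in the realization of `Y_r`, and the class of `γ ⋆ p ⋆ γ⁻¹`
is the component of `x` at range `r`. -/
def Represents (β : ω.Basing r₀) (ζ : Trail β.y β.y) (x : ω.properPi1 r₀) : Prop :=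
  ζ.InSet (Y ∩ unflawed 𝔄 a β.idx.r) ∧
  ∃ p : Path (X := region 𝔄 a Y β.idx.r) ⟨toReal β.y, β.mem⟩ ⟨toReal β.y, β.mem⟩,
    (∀ s, (p s : Fin D → ℝ) = ζ.path s) ∧
    FundamentalGroup.fromPath
      (Path.Homotopic.Quotient.mk ((β.γ.trans p).trans β.γ.symm)) = x.1 β.idx

end ProperBaseRay

/-- Projective codimension-two defect: the proper fundamental group is nontrivial (for some
proper base ray). -/
def HasProjectiveCodimTwo {D : ℕ} {A : Type*} [TopologicalSpace A] (𝔄 : Subshift A (Lat D))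
    (a : Lat D → A) (r₀ : ℕ) (Y : Set (Lat D)) : Prop :=
  ∃ ω : ProperBaseRay 𝔄 a Y, Nontrivial (ω.properPi1 r₀)

/-! ## Dynamical cocycles -/

/-- The shift as a self-map of a subshift. -/
def shiftOn {D : ℕ} {A : Type*} [TopologicalSpace A] (𝔄 : Subshift A (Lat D)) (z : Lat D)
    (b : 𝔄.carrier) : 𝔄.carrier :=
  ⟨shift z b, 𝔄.mapsTo z b.2⟩

section Cocycles

variable {D : ℕ} {A : Type*} [TopologicalSpace A] (𝔄 : Subshift A (Lat D)) (G : Type*)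

/-- Continuous dynamical cocycles. -/
def cocycles [Group G] [TopologicalSpace G] : Set (Lat D → 𝔄.carrier → G) :=
  {C | Continuous (fun p : Lat D × 𝔄.carrier => C p.1 p.2) ∧
    ∀ y z b, C (y + z) b = C y (shiftOn 𝔄 z b) * C z b}

variable {G} in
/-- Two cocycles are cohomologous if they are related by a continuous transfer function. -/
def Cohomologous [Group G] [TopologicalSpace G] (C C' : Lat D → 𝔄.carrier → G) : Prop :=
  ∃ b : 𝔄.carrier → G, Continuous b ∧
    ∀ z x, C' z x = b (shiftOn 𝔄 z x) * C z x * (b x)⁻¹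

/-- Cohomology as an equivalence relation on cocycles, `G` being discrete. -/
def cohomSetoid [Group G] [TopologicalSpace G] [DiscreteTopology G] :
    Setoid (cocycles 𝔄 G) where
  r C C' := Cohomologous 𝔄 C.1 C'.1
  iseqv :=
    { refl := fun C => ⟨fun _ => 1, continuous_const, by simp⟩
      symm := by
        rintro C C' ⟨b, hb, h⟩
        exact ⟨fun x => (b x)⁻¹, hb.inv, fun z x => by rw [h]; group⟩
      trans := by
        rintro C C' C'' ⟨b, hb, h⟩ ⟨b', hb', h'⟩
        exact ⟨fun x => b' x * b x, hb'.mul hb, fun z x => by rw [h', h]; group⟩ }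

/-- The set of cohomology classes of continuous cocycles. -/
def H1 [Group G] [TopologicalSpace G] [DiscreteTopology G] : Type _ :=
  Quotient (cohomSetoid 𝔄 G)

/-- For abelian `G`, the cocycles form a group under pointwise multiplication. -/
def cocycleGroup [CommGroup G] [TopologicalSpace G] [DiscreteTopology G] :
    Subgroup (Lat D → 𝔄.carrier → G) where
  carrier := cocycles 𝔄 G
  one_mem' := ⟨continuous_const, by simp⟩
  mul_mem' := by
    rintro C C' ⟨h₁, h₂⟩ ⟨h₁', h₂'⟩
    refine ⟨h₁.mul h₁', fun y z b => ?_⟩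
    simp only [Pi.mul_apply, h₂, h₂', mul_mul_mul_comm]
  inv_mem' := by
    rintro C ⟨h₁, h₂⟩
    refine ⟨h₁.inv, fun y z b => ?_⟩
    simp only [Pi.inv_apply, h₂, mul_inv]

/-- For abelian `G`, the subgroup of trivial cocycles: those cohomologous to a homomorphism
`ℤ^D → G`. -/
def trivialCocycles [CommGroup G] [TopologicalSpace G] [DiscreteTopology G] :
    Subgroup (cocycleGroup 𝔄 G) where
  carrier := {C | ∃ h : Multiplicative (Lat D) →* G,
    Cohomologous 𝔄 (fun z _ => h (Multiplicative.ofAdd z)) C.1}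
  one_mem' := ⟨1, fun _ => 1, continuous_const, by simp⟩
  mul_mem' := by
    rintro C C' ⟨h, b, hb, e⟩ ⟨h', b', hb', e'⟩
    refine ⟨h * h', fun x => b x * b' x, hb.mul hb', fun z x => ?_⟩
    have : (C * C').1 z x = C.1 z x * C'.1 z x := rfl
    rw [this, e, e']
    simp only [MonoidHom.mul_apply, mul_inv]
    ac_rfl
  inv_mem' := by
    rintro C ⟨h, b, hb, e⟩
    refine ⟨h⁻¹, fun x => (b x)⁻¹, hb.inv, fun z x => ?_⟩
    have : (C⁻¹).1 z x = (C.1 z x)⁻¹ := rfl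
    rw [this, e]
    simp only [MonoidHom.inv_apply, mul_inv]

/-- For abelian `G`, the first dynamical cohomology group. -/
abbrev H1Group [CommGroup G] [TopologicalSpace G] [DiscreteTopology G] : Type _ :=
  cocycleGroup 𝔄 G ⧸ trivialCocycles 𝔄 G

variable {G}

/-- `c` is a local rule of radius `s` for the cocycle `C`. Only the values of `c` at unit steps
and admissible blocks matter. -/
def IsLocalRule (C : Lat D → 𝔄.carrier → G) (s : ℕ) (c : Lat D → (box D s → A) → G) : Prop :=
  ∀ e ∈ unitSteps D, ∀ b : 𝔄.carrier, c e (block s b.1 0) = C e b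

end Cocycles

/-- The value `c(ζ, a)` of a local rule along a trail: the product of
`c(z_n - z_{n-1}, a_{B(z_{n-1}, s)})`, with later steps on the left, as in the cocycle equation. -/
def Trail.value {D s : ℕ} {A G : Type*} [Group G] (c : Lat D → (box D s → A) → G)
    (a : Lat D → A) {y z : Lat D} : Trail y z → G
  | .nil => 1
  | .cons (v := v) _ p => Trail.value c a p * c (v - y) (block s a y)

/-- `ρ` is the residue function `x ↦ C(ζ, a)` of the cohomology class `κ`: whatever the
representing cocycle, its radius `s` and local rule, the range `r > s` and the base points, the
values along all trails `ζ` in `Y_r` representing `x` are given by `ρ x`, up to a conjugation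
that does not depend on `x` or `ζ`. -/
def IsResidue {D : ℕ} {A : Type*} [TopologicalSpace A] {𝔄 : Subshift A (Lat D)}
    {a : Lat D → A} {Y : Set (Lat D)} {r₀ : ℕ} (ω : ProperBaseRay 𝔄 a Y)
    {G : Type*} [Group G] [TopologicalSpace G] [DiscreteTopology G]
    (κ : H1 𝔄 G) (ρ : ω.properPi1 r₀ → G) : Prop :=
  ∀ C : cocycles 𝔄 G, (Quotient.mk (cohomSetoid 𝔄 G) C : H1 𝔄 G) = κ →
  ∀ (s : ℕ) (c : Lat D → (box D s → A) → G), IsLocalRule 𝔄 C.1 s c →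
  ∀ β : ω.Basing r₀, s < β.idx.r →
    ∃ g : G, ∀ (x : ω.properPi1 r₀) (ζ : Trail β.y β.y),
      ProperBaseRay.Represents β ζ x → ζ.value c a = g * ρ x * g⁻¹

end CrystalDefect

/-!
Around each site `z` of the unflawed region of range `R`, the configuration `a` looks like some
`b_z` in the subshift. The elements `C (w - v) b_v`, for corners `v`, `w` of a common cube, are
therefore transition functions of a flat `G`-bundle over the cubical realization, with the open
stars of the lattice points as charts. The value of a local rule along a trail is the monodromy of
this bundle along the piecewise linear path of the trail, so it only depends on the homotopy class
of that path. Cutting a path into pieces that lie in open stars shows that every homotopy class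
between lattice points is the class of a trail. Moving the base point conjugates the values, and so
does a transfer function, on ranges that exceed its radius. If the defect is removable, then all
the `b_z` are shifts of a single point of the subshift, and the cocycle equation makes the values
along closed trails trivial.
-/

namespace CrystalDefect

open Filter

section Lattice

variable {D : ℕ} {A : Type*}

theorem box_mono {r s : ℕ} (h : r ≤ s) : box D r ⊆ box D s :=
  fun _ hu i => (hu i).trans (Nat.cast_le.mpr h)

theorem add_mem_box {r s : ℕ} {u v : Lat D} (hu : u ∈ box D r) (hv : v ∈ box D s) :
    u + v ∈ box D (r + s) := fun i => by
  push_cast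
  exact (abs_add_le _ _).trans (add_le_add (hu i) (hv i))

theorem exists_mem_box (u : Lat D) : ∃ r, u ∈ box D r := by
  refine ⟨∑ i, (u i).natAbs, fun i => ?_⟩
  rw [Int.abs_eq_natAbs]
  exact_mod_cast Finset.single_le_sum (f := fun i => (u i).natAbs)
    (fun _ _ => Nat.zero_le _) (Finset.mem_univ i)

theorem unitSteps_subset_box : unitSteps D ⊆ box D 1 := by
  rintro e ⟨i, rfl | rfl⟩ j <;> rcases eq_or_ne j i with rfl | h <;> simp [*]

theorem finite_unitSteps (D : ℕ) : (unitSteps D).Finite := by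
  have hbox : box D 1 ⊆ Set.Icc (fun _ => -1) fun _ => 1 :=
    fun u hu => ⟨fun i => (abs_le.mp (hu i)).1, fun i => (abs_le.mp (hu i)).2⟩
  exact (Set.finite_Icc _ _).subset (unitSteps_subset_box.trans hbox)

theorem block_eq_iff {r : ℕ} {a b : Lat D → A} {y z : Lat D} :
    block r a y = block r b z ↔ ∀ u ∈ box D r, a (y + u) = b (z + u) :=
  ⟨fun h u hu => congrFun h ⟨u, hu⟩, fun h => funext fun u => h u u.2⟩

theorem block_eq_of_le {r s : ℕ} (h : r ≤ s) {a b : Lat D → A} {y z : Lat D}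
    (hab : block s a y = block s b z) : block r a y = block r b z :=
  block_eq_iff.mpr fun u hu => block_eq_iff.mp hab u (box_mono h hu)

theorem block_add_eq {r s t : ℕ} {a b : Lat D → A} {y z u : Lat D}
    (hab : block t a y = block t b z) (hu : u ∈ box D s) (h : s + r ≤ t) :
    block r a (y + u) = block r b (z + u) := by
  refine block_eq_iff.mpr fun v hv => ?_
  rw [add_assoc, add_assoc]
  exact block_eq_iff.mp hab (u + v) (box_mono h (add_mem_box hu hv))

theorem block_shift (r : ℕ) (a : Lat D → A) (v z : Lat D) :
    block r (shift v a) z = block r a (v + z) :=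
  funext fun u => congrArg a (add_assoc v z u).symm

end Lattice

section Unflawed

variable {D : ℕ} {A : Type*} [TopologicalSpace A] {𝔄 : Subshift A (Lat D)} {a : Lat D → A}

theorem mem_unflawed_iff {R : ℕ} (hR : 0 < R) {z : Lat D} :
    z ∈ unflawed 𝔄 a R ↔ block R a z ∈ admissible 𝔄 R := by
  refine ⟨fun h => ?_, fun h => le_iSup₂
    (f := fun (r : ℕ) (_ : block r a z ∈ admissible 𝔄 r) => (r : ℕ∞)) R h⟩
  have hlt : ((R - 1 : ℕ) : ℕ∞) < energy 𝔄 a z :=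
    lt_of_lt_of_le (Nat.cast_lt.mpr (Nat.sub_one_lt hR.ne')) h
  simp only [energy, lt_iSup_iff, Nat.cast_lt] at hlt
  obtain ⟨r, ⟨b, hb, hbr⟩, hr⟩ := hlt
  exact ⟨b, hb, block_eq_of_le (by omega) hbr⟩

theorem add_mem_unflawed {r s : ℕ} (hr : 0 < r) {z u : Lat D} (hz : z ∈ unflawed 𝔄 a (s + r))
    (hu : u ∈ box D s) : z + u ∈ unflawed 𝔄 a r := by
  obtain ⟨b, hb, hbz⟩ := (mem_unflawed_iff (by omega)).mp hz
  refine (mem_unflawed_iff hr).mpr ⟨shift u b, 𝔄.mapsTo u hb, ?_⟩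
  rw [block_shift, add_zero, ← block_add_eq hbz hu le_rfl, zero_add]

theorem exists_local_model {R : ℕ} (hR : 0 < R) (h : (unflawed 𝔄 a R).Nonempty) :
    ∃ p : Lat D → 𝔄.carrier, ∀ z ∈ unflawed 𝔄 a R, block R (p z).1 0 = block R a z := by
  have hex : ∀ z ∈ unflawed 𝔄 a R, ∃ b : 𝔄.carrier, block R b.1 0 = block R a z := fun z hz => by
    obtain ⟨b, hb, hbz⟩ := (mem_unflawed_iff hR).mp hz
    exact ⟨⟨b, hb⟩, hbz⟩
  have : Nonempty 𝔄.carrier := ⟨(hex _ h.some_mem).choose⟩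
  choose! p hp using hex
  exact ⟨p, hp⟩

end Unflawed

section Trails

variable {D : ℕ}

theorem Trail.inSet_cons_iff {S : Set (Lat D)} {x y z : Lat D} (h : (latGraph D).Adj x y)
    (p : Trail y z) :
    Trail.InSet (SimpleGraph.Walk.cons h p : Trail x z) S ↔ x ∈ S ∧ p.InSet S := by
  simp only [Trail.InSet, SimpleGraph.Walk.support_cons, List.mem_cons, forall_eq_or_imp]

theorem Trail.InSet.start_mem {S : Set (Lat D)} {y z : Lat D} {ζ : Trail y z} (h : ζ.InSet S) :
    y ∈ S :=
  h y (SimpleGraph.Walk.start_mem_support ζ)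

theorem Trail.InSet.mono {S T : Set (Lat D)} {y z : Lat D} {ζ : Trail y z} (h : ζ.InSet S)
    (hST : S ⊆ T) : ζ.InSet T :=
  fun v hv => hST (h v hv)

theorem Trail.value_append {A G : Type*} [Group G] {s : ℕ} (c : Lat D → (box D s → A) → G)
    (a : Lat D → A) {x y z : Lat D} (ζ : Trail x y) (ξ : Trail y z) :
    Trail.value c a (SimpleGraph.Walk.append ζ ξ) = Trail.value c a ξ * Trail.value c a ζ := by
  induction ζ with
  | nil => exact (mul_one _).symm
  | cons h p ih => simp only [SimpleGraph.Walk.cons_append, Trail.value, ih, mul_assoc]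

theorem Trail.value_eq_of_monoidHom {A G : Type*} [Group G] (h : Multiplicative (Lat D) →* G)
    {s : ℕ} (a : Lat D → A) {y z : Lat D} (ζ : Trail y z) :
    Trail.value (fun e (_ : box D s → A) => h (.ofAdd e)) a ζ = h (.ofAdd (z - y)) := by
  induction ζ with
  | nil => rw [sub_self, ofAdd_zero, map_one, Trail.value]
  | @cons y x z _ ζ ih => rw [Trail.value, ih, ← map_mul, ← ofAdd_add, sub_add_sub_cancel]

theorem Trail.value_mul {A G : Type*} [CommGroup G] {s : ℕ} (c c' : Lat D → (box D s → A) → G)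
    (a : Lat D → A) {y z : Lat D} (ζ : Trail y z) :
    Trail.value (fun e w => c e w * c' e w) a ζ = Trail.value c a ζ * Trail.value c' a ζ := by
  induction ζ with
  | nil => exact (mul_one _).symm
  | cons _ _ ih => simp only [Trail.value, ih, mul_mul_mul_comm]

theorem sub_mem_box_of_mem_corners {c v w : Lat D} (hv : v ∈ corners c) (hw : w ∈ corners c) :
    w - v ∈ box D 1 := fun i => by
  rw [Pi.sub_apply, abs_le]
  rcases hv i with h | h <;> rcases hw i with h' | h' <;> constructor <;> push_cast <;> omega

theorem update_eq_or_adj {c v w : Lat D} (hv : v ∈ corners c) (hw : w ∈ corners c)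
    (i : Fin D) :
    Function.update v i (w i) = v ∨ (latGraph D).Adj v (Function.update v i (w i)) := by
  have hsub : Function.update v i (w i) - v = Pi.single i (w i - v i) := by
    funext j
    rcases eq_or_ne j i with rfl | hj <;> simp [*]
  have hcases : w i = v i ∨ w i - v i = 1 ∨ w i - v i = -1 := by
    rcases hv i with h | h <;> rcases hw i with h' | h' <;> omega
  refine hcases.imp (fun h => by rw [h, Function.update_eq_self]) fun h => ⟨i, ?_⟩
  rw [hsub]
  exact h.imp (congrArg _) (congrArg _)

theorem exists_trail_inSet_corners {c v w : Lat D} (hv : v ∈ corners c) (hw : w ∈ corners c) :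
    ∃ ζ : Trail v w, ζ.InSet (corners c) := by
  suffices ∀ s : Finset (Fin D), ∀ v ∈ corners c, (∀ i ∉ s, v i = w i) →
      ∃ ζ : Trail v w, ζ.InSet (corners c) from
    this Finset.univ v hv fun i hi => absurd (Finset.mem_univ i) hi
  intro s
  induction s using Finset.induction with
  | empty =>
    intro v hv h
    obtain rfl : v = w := funext fun i => h i (Finset.notMem_empty i)
    exact ⟨.nil, by simpa only [Trail.InSet, SimpleGraph.Walk.support_nil, List.mem_singleton,
      forall_eq] using hv⟩
  | insert i s _ ih =>
    intro v hv h
    have hu : Function.update v i (w i) ∈ corners c := fun j => by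
      rcases eq_or_ne j i with rfl | hj
      · simpa only [Function.update_self] using hw j
      · simpa only [Function.update_of_ne hj] using hv j
    obtain ⟨ζ, hζ⟩ := ih (Function.update v i (w i)) hu fun j hj => by
      rcases eq_or_ne j i with rfl | hji
      · exact Function.update_self ..
      · rw [Function.update_of_ne hji]
        exact h j (by simp only [Finset.mem_insert, hji, hj, or_self, not_false_eq_true])
    rcases update_eq_or_adj hv hw i with heq | hadj
    · exact heq ▸ ⟨ζ, hζ⟩
    · exact ⟨.cons hadj ζ, (Trail.inSet_cons_iff hadj ζ).mpr ⟨hv, hζ⟩⟩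

end Trails

section LocalRules

variable {D : ℕ} {A : Type*} [TopologicalSpace A] {𝔄 : Subshift A (Lat D)}

theorem shiftOn_zero (b : 𝔄.carrier) : shiftOn 𝔄 0 b = b :=
  Subtype.ext (shift_zero b.1)

theorem shiftOn_add (y z : Lat D) (b : 𝔄.carrier) :
    shiftOn 𝔄 (y + z) b = shiftOn 𝔄 z (shiftOn 𝔄 y b) :=
  Subtype.ext (shift_add y z b.1)

theorem block_shiftOn (s : ℕ) (z : Lat D) (b : 𝔄.carrier) :
    block s (shiftOn 𝔄 z b).1 0 = block s b.1 z := by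
  rw [shiftOn, block_shift, add_zero]

theorem cocycle_zero {G : Type*} [Group G] [TopologicalSpace G] {C : Lat D → 𝔄.carrier → G}
    (hC : C ∈ cocycles 𝔄 G) (b : 𝔄.carrier) : C 0 b = 1 := by
  have h := hC.2 0 0 b
  rw [add_zero, shiftOn_zero] at h
  exact mul_eq_left.mp h.symm

theorem IsLocalRule.value_eq {G : Type*} [Group G] [TopologicalSpace G]
    {C : Lat D → 𝔄.carrier → G} {s : ℕ} {c : Lat D → (box D s → A) → G}
    (hc : IsLocalRule 𝔄 C s c) (hC : C ∈ cocycles 𝔄 G) {a : Lat D → A} {p : 𝔄.carrier}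
    {u v w : Lat D} (ζ : Trail v w)
    (h : ∀ x ∈ SimpleGraph.Walk.support ζ, block s a x = block s p.1 (x - u)) :
    Trail.value c a ζ = C (w - v) (shiftOn 𝔄 (v - u) p) := by
  induction ζ with
  | nil => rw [sub_self, cocycle_zero hC, Trail.value]
  | @cons v x w hadj ζ ih =>
    rw [SimpleGraph.Walk.support_cons, List.forall_mem_cons] at h
    have hstep := hc (x - v) hadj (shiftOn 𝔄 (v - u) p)
    rw [block_shiftOn, ← h.1] at hstep
    rw [Trail.value, ih h.2, hstep, ← sub_add_sub_cancel w x v, hC.2, ← shiftOn_add,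
      sub_add_sub_cancel']

theorem IsLocalRule.value_eq_of_corners {G : Type*} [Group G] [TopologicalSpace G]
    {C : Lat D → 𝔄.carrier → G} {s R : ℕ} {c : Lat D → (box D s → A) → G}
    (hc : IsLocalRule 𝔄 C s c) (hC : C ∈ cocycles 𝔄 G) (hs : s < R) {a : Lat D → A}
    {p : 𝔄.carrier} {x u v w : Lat D} (hp : block R p.1 0 = block R a u) (hu : u ∈ corners x)
    {ζ : Trail v w} (hζ : ζ.InSet (corners x)) :
    Trail.value c a ζ = C (w - v) (shiftOn 𝔄 (v - u) p) :=
  hc.value_eq hC ζ fun y hy => by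
    rw [← zero_add (y - u), block_add_eq hp (sub_mem_box_of_mem_corners hu (hζ y hy))
      (by omega : 1 + s ≤ R), add_sub_cancel]

theorem eventually_factorsThrough_block [CompactSpace A] [T2Space A] {X : Type*}
    [TopologicalSpace X] [DiscreteTopology X] {f : 𝔄.carrier → X} (hf : Continuous f) :
    ∀ᶠ s in atTop, Function.FactorsThrough f fun b : 𝔄.carrier => block s b.1 0 := by
  have : CompactSpace 𝔄.carrier := isCompact_iff_compactSpace.mp 𝔄.isClosed.isCompact
  let K (s : ℕ) : Set (𝔄.carrier × 𝔄.carrier) :=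
    {q | block s q.1.1 0 = block s q.2.1 0 ∧ f q.1 ≠ f q.2}
  have hclosed (s : ℕ) : IsClosed (K s) := by
    have hblock : Continuous fun b : 𝔄.carrier => block s b.1 0 :=
      continuous_pi fun _ => (continuous_apply _).comp continuous_subtype_val
    exact (isClosed_eq (hblock.comp continuous_fst) (hblock.comp continuous_snd)).inter
      ((isClosed_discrete {x : X × X | x.1 ≠ x.2}).preimage (hf.prodMap hf))
  have hinter : ⋂ s, K s = ∅ := by
    refine Set.eq_empty_of_forall_notMem fun q hq => ?_
    rw [Set.mem_iInter] at hq
    refine (hq 0).2 (congrArg f (Subtype.ext (funext fun z => ?_)))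
    obtain ⟨s, hs⟩ := exists_mem_box z
    simpa only [zero_add] using block_eq_iff.mp (hq s).1 z hs
  obtain ⟨s, hs⟩ : ∃ s, K s = ∅ := by
    by_contra! hne
    refine (IsCompact.nonempty_iInter_of_sequence_nonempty_isCompact_isClosed K
      (fun s q hq => ⟨block_eq_of_le s.le_succ hq.1, hq.2⟩) hne (hclosed 0).isCompact
      hclosed).ne_empty hinter
  filter_upwards [eventually_ge_atTop s] with t ht b b' hb
  by_contra hne
  exact (hs ▸ ⟨block_eq_of_le ht hb, hne⟩ : (b, b') ∈ (∅ : Set (𝔄.carrier × 𝔄.carrier)))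

theorem eventually_exists_isLocalRule [CompactSpace A] [T2Space A] {G : Type*} [Group G]
    [TopologicalSpace G] [DiscreteTopology G] {C : Lat D → 𝔄.carrier → G}
    (hC : C ∈ cocycles 𝔄 G) : ∀ᶠ s in atTop, ∃ c, IsLocalRule 𝔄 C s c := by
  have hfactor : ∀ᶠ s in atTop, ∀ e ∈ unitSteps D,
      Function.FactorsThrough (C e) fun b : 𝔄.carrier => block s b.1 0 :=
    (eventually_all_finite (finite_unitSteps D)).mpr fun e _ =>
      eventually_factorsThrough_block (hC.1.comp (Continuous.prodMk_right e))
  filter_upwards [hfactor] with s hs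
  exact ⟨fun e => Function.extend (fun b : 𝔄.carrier => block s b.1 0) (C e) 1,
    fun e he b => (hs e he).extend_apply 1 b⟩

theorem Cohomologous.eventually_value_eq [CompactSpace A] [T2Space A] {G : Type*} [Group G]
    [TopologicalSpace G] [DiscreteTopology G] {C C' : Lat D → 𝔄.carrier → G}
    (h : Cohomologous 𝔄 C C') {s s' : ℕ} {c : Lat D → (box D s → A) → G}
    {c' : Lat D → (box D s' → A) → G} (hc : IsLocalRule 𝔄 C s c) (hc' : IsLocalRule 𝔄 C' s' c')
    (a : Lat D → A) :
    ∀ᶠ R in atTop, ∃ g : Lat D → G, ∀ (y z : Lat D) (ζ : Trail y z),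
      ζ.InSet (unflawed 𝔄 a R) →
        Trail.value c' a ζ = g z * Trail.value c a ζ * (g y)⁻¹ := by
  obtain ⟨f, hf, hC'⟩ := h
  obtain ⟨n, hn⟩ := (eventually_factorsThrough_block hf).exists
  filter_upwards [eventually_ge_atTop (n + s + s' + 1)] with R hR
  rcases (unflawed 𝔄 a R).eq_empty_or_nonempty with hempty | hne
  · exact ⟨1, fun y z ζ hζ => absurd hζ.start_mem (hempty ▸ Set.notMem_empty y)⟩
  obtain ⟨p, hp⟩ := exists_local_model (by omega) hne
  have hstep : ∀ v ∈ unflawed 𝔄 a R, ∀ x ∈ unflawed 𝔄 a R, x - v ∈ unitSteps D →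
      c' (x - v) (block s' a v) = f (p x) * c (x - v) (block s a v) * (f (p v))⁻¹ := by
    intro v hv x hx he
    have hblock : block n (shiftOn 𝔄 (x - v) (p v)).1 0 = block n (p x).1 0 := by
      rw [block_shiftOn, block_eq_of_le (by omega) (hp x hx), ← zero_add (x - v),
        block_add_eq (hp v hv) (unitSteps_subset_box he) (by omega : 1 + n ≤ R), add_sub_cancel]
    rw [← block_eq_of_le (by omega) (hp v hv), ← block_eq_of_le (by omega) (hp v hv), hc _ he,
      hc' _ he, hC', hn hblock]
  refine ⟨f ∘ p, fun y z ζ hζ => ?_⟩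
  induction ζ with
  | nil => simp only [Trail.value, mul_one, mul_inv_cancel]
  | @cons y x z hadj ζ ih =>
    rw [Trail.inSet_cons_iff] at hζ
    rw [Trail.value, Trail.value, ih hζ.2, hstep y hζ.1 x hζ.2.start_mem hadj]
    simp only [Function.comp_apply]
    group

end LocalRules

section PathClasses

open Path

variable {X : Type*} [TopologicalSpace X]

theorem pathClass_induction {ι : Type*} {U : ι → Set X} (hU : ∀ i, IsOpen (U i))
    (hcover : ∀ x, ∃ i, x ∈ U i) {P : ∀ p q : X, Homotopic.Quotient p q → Prop}
    (htrans : ∀ {p q r : X} {γ : Homotopic.Quotient p q} {γ' : Homotopic.Quotient q r},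
      P p q γ → P q r γ' → P p r (γ.trans γ'))
    (hlocal : ∀ (i : ι) {p q : X} (γ : Path p q), (∀ t, γ t ∈ U i) → P p q (.mk γ))
    {p q : X} (γ : Homotopic.Quotient p q) : P p q γ := by
  induction γ using Homotopic.Quotient.ind with | mk γ => ?_
  have of_cast : ∀ {p' q' : X} (hp : p' = p) (hq : q' = q), P p' q' (.mk (γ.cast hp hq)) →
      P p q (.mk γ) := by
    rintro _ _ rfl rfl h
    exact h
  obtain ⟨t, t_zero, t_mono, ⟨N, hN⟩, hsub⟩ :=
    exists_monotone_Icc_subset_open_cover_unitInterval (c := fun i => γ ⁻¹' U i)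
      (fun i => (hU i).preimage γ.continuous)
      (fun s _ => Set.mem_iUnion.mpr (hcover (γ s)))
  have hpiece (n : ℕ) : P _ _ (.mk (γ.subpath (t n) (t (n + 1)))) := by
    obtain ⟨i, hi⟩ := hsub n
    refine hlocal i _ fun s => ?_
    have hs := Set.mem_range_self (f := γ.subpath (t n) (t (n + 1))) s
    rw [Path.range_subpath_of_le _ _ _ (t_mono n.le_succ)] at hs
    exact Set.image_subset_iff.mpr hi hs
  have hinitial (n : ℕ) : P _ _ (.mk (γ.subpath (t 0) (t n))) := by
    induction n with
    | zero =>
      obtain ⟨i, hi⟩ := hcover (γ (t 0))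
      exact hlocal i _ fun s => by rwa [Path.subpath_self]
    | succ n ih =>
      have h := htrans ih (hpiece n)
      rwa [← Homotopic.Quotient.mk_trans, Homotopic.Quotient.eq.mpr
        ⟨Path.Homotopy.subpathTransSubpath γ (t 0) (t n) (t (n + 1))⟩] at h
  have h := hinitial N
  rw [t_zero, hN N le_rfl, Path.subpath_zero_one] at h
  exact of_cast _ _ h

variable {W : Set X} {p q r : X}

theorem trans_symm_eq_iff {γ : Homotopic.Quotient p r} {γ' : Homotopic.Quotient q r}
    {δ : Homotopic.Quotient p q} : γ.trans γ'.symm = δ ↔ γ = δ.trans γ' := by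
  constructor <;> rintro rfl
  · rw [Homotopic.Quotient.trans_assoc, Homotopic.Quotient.symm_trans,
      Homotopic.Quotient.trans_refl]
  · rw [Homotopic.Quotient.trans_assoc, Homotopic.Quotient.trans_symm,
      Homotopic.Quotient.trans_refl]

theorem trans_symm_trans_cancel (γ : Homotopic.Quotient p q) (δ : Homotopic.Quotient p r) :
    γ.trans (γ.symm.trans δ) = δ := by
  rw [← Homotopic.Quotient.trans_assoc, Homotopic.Quotient.trans_symm,
    Homotopic.Quotient.refl_trans]

theorem square_trans {p' q' r' : X} {γ : Homotopic.Quotient p q} {δ : Homotopic.Quotient q r}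
    {γ' : Homotopic.Quotient p' q'} {δ' : Homotopic.Quotient q' r'} {α : Homotopic.Quotient p p'}
    {β : Homotopic.Quotient q q'} {ε : Homotopic.Quotient r r'} (h : γ.trans β = α.trans γ')
    (h' : δ.trans ε = β.trans δ') : (γ.trans δ).trans ε = α.trans (γ'.trans δ') := by
  rw [Homotopic.Quotient.trans_assoc, h', ← Homotopic.Quotient.trans_assoc, h,
    Homotopic.Quotient.trans_assoc]

theorem square_symm {p' q' : X} {γ : Homotopic.Quotient p q} {γ' : Homotopic.Quotient p' q'}
    {α : Homotopic.Quotient p p'} {β : Homotopic.Quotient q q'} (h : γ.trans β = α.trans γ') :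
    γ.symm.trans α = β.trans γ'.symm := by
  rw [eq_comm, trans_symm_eq_iff, Homotopic.Quotient.trans_assoc, ← h,
    ← Homotopic.Quotient.trans_assoc, Homotopic.Quotient.symm_trans, Homotopic.Quotient.refl_trans]

theorem map_trans {Z : Type*} [TopologicalSpace Z] (f : C(X, Z)) (γ : Homotopic.Quotient p q)
    (δ : Homotopic.Quotient q r) : (γ.trans δ).map f = (γ.map f).trans (δ.map f) :=
  (FundamentalGroupoid.map f).map_comp (X := .mk p) (Y := .mk q) (Z := .mk r) γ δ

theorem square_map {Z : Type*} [TopologicalSpace Z] (f : C(X, Z)) {p' q' : X}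
    {γ : Homotopic.Quotient p q} {γ' : Homotopic.Quotient p' q'} {α : Homotopic.Quotient p p'}
    {β : Homotopic.Quotient q q'} (h : γ.trans β = α.trans γ') :
    (γ.map f).trans (β.map f) = (α.map f).trans (γ'.map f) := by
  rw [← map_trans, h, map_trans]

/-- A path in `X` whose points all lie in `W`, as a path in the subspace `W`. -/
def pathInto (γ : Path p q) (h : ∀ t, γ t ∈ W) (hp : p ∈ W) (hq : q ∈ W) :
    Path (⟨p, hp⟩ : W) ⟨q, hq⟩ where
  toFun t := ⟨γ t, h t⟩
  continuous_toFun := γ.continuous.subtype_mk h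
  source' := Subtype.ext γ.source
  target' := Subtype.ext γ.target

theorem pathInto_trans (γ : Path p q) (γ' : Path q r) (h : ∀ t, γ t ∈ W) (h' : ∀ t, γ' t ∈ W)
    (h'' : ∀ t, γ.trans γ' t ∈ W) (hp : p ∈ W) (hq : q ∈ W) (hr : r ∈ W) :
    pathInto (γ.trans γ') h'' hp hr = (pathInto γ h hp hq).trans (pathInto γ' h' hq hr) := by
  ext t
  simp only [pathInto, Path.trans_apply, Path.coe_mk', ContinuousMap.coe_mk]
  split_ifs <;> rfl

theorem forall_trans_mem_iff {γ : Path p q} {γ' : Path q r} :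
    (∀ t, γ.trans γ' t ∈ W) ↔ (∀ t, γ t ∈ W) ∧ ∀ t, γ' t ∈ W := by
  simp only [← Set.range_subset_iff, Path.trans_range, Set.union_subset_iff]

theorem homotopic_of_starConvex {E : Type*} [AddCommGroup E] [Module ℝ E] [TopologicalSpace E]
    [ContinuousAdd E] [ContinuousSMul ℝ E] {X W : Set E} {v : E} (hW : StarConvex ℝ v W)
    (hWX : W ⊆ X) {p q : X} {γ γ' : Path p q} (h : ∀ t, (γ t : E) ∈ W)
    (h' : ∀ t, (γ' t : E) ∈ W) : γ.Homotopic γ' := by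
  have hp : (p : E) ∈ W := γ.source ▸ h 0
  have hq : (q : E) ∈ W := γ.target ▸ h 1
  have : ContractibleSpace W := hW.contractibleSpace ⟨_, hp⟩
  have hhom : (pathInto (γ.map continuous_subtype_val) h hp hq).Homotopic
      (pathInto (γ'.map continuous_subtype_val) h' hp hq) :=
    SimplyConnectedSpace.paths_homotopic _ _
  exact hhom.map ⟨Set.inclusion hWX, continuous_inclusion hWX⟩

theorem segment_mem_of_convex {E : Type*} [AddCommGroup E] [Module ℝ E] [TopologicalSpace E]
    [ContinuousAdd E] [ContinuousSMul ℝ E] {W : Set E} (hW : Convex ℝ W) {p q : E}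
    (hp : p ∈ W) (hq : q ∈ W) (t : I) : Path.segment p q t ∈ W :=
  hW.segment_subset hp hq (Path.range_segment p q ▸ Set.mem_range_self t)

end PathClasses

section Stars

variable {D : ℕ}

theorem convex_cube (z : Lat D) : Convex ℝ (cube z) := by
  have hpi : cube z = Set.univ.pi fun i => Set.Icc (z i : ℝ) (z i + 1) := by
    simp only [cube, Set.pi, Set.mem_univ, forall_const, Set.mem_Icc]
  exact hpi ▸ convex_pi fun _ _ => convex_Icc _ _

theorem toReal_mem_cube {v z : Lat D} (hv : v ∈ corners z) : toReal v ∈ cube z := fun i => by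
  rcases hv i with h | h <;> simp [toReal, h]

theorem cube_subset_realization {S : Set (Lat D)} {z : Lat D} (h : corners z ⊆ S) :
    cube z ⊆ realization S :=
  fun _ hp => ⟨z, h, hp⟩

/-- The open star of the lattice point `v` in the cubical structure of `ℝ^D`: the interior of the
union of the unit cubes with `v` as a corner. -/
def openStar (v : Lat D) : Set (Fin D → ℝ) :=
  Set.univ.pi fun i => Set.Ioo ((v i : ℝ) - 1) (v i + 1)

theorem isOpen_openStar (v : Lat D) : IsOpen (openStar v) :=
  isOpen_set_pi Set.finite_univ fun _ _ => isOpen_Ioo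

theorem convex_openStar (v : Lat D) : Convex ℝ (openStar v) :=
  convex_pi fun _ _ => convex_Ioo _ _

theorem toReal_mem_openStar (v : Lat D) : toReal v ∈ openStar v :=
  fun _ _ => ⟨sub_one_lt _, lt_add_one _⟩

theorem mem_openStar_floor (p : Fin D → ℝ) : p ∈ openStar fun i => ⌊p i⌋ :=
  fun i _ => ⟨(sub_one_lt _).trans_le (Int.floor_le (p i)), Int.lt_floor_add_one (p i)⟩

theorem floor_toReal (v : Lat D) : (fun i => ⌊toReal v i⌋) = v :=
  funext fun i => Int.floor_intCast (v i)

theorem mem_corners_of_mem_openStar {p : Fin D → ℝ} {v z : Lat D} (hp : p ∈ cube z)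
    (hv : p ∈ openStar v) : v ∈ corners z := fun i => by
  have hlower : ((z i - 1 : ℤ) : ℝ) < v i := by
    push_cast
    linarith [(hv i trivial).2, (hp i).1]
  have hupper : (v i : ℝ) < (z i + 2 : ℤ) := by
    push_cast
    linarith [(hv i trivial).1, (hp i).2]
  have := Int.cast_lt.mp hlower
  have := Int.cast_lt.mp hupper
  omega

theorem mem_of_toReal_mem_realization {S : Set (Lat D)} {v : Lat D}
    (h : toReal v ∈ realization S) : v ∈ S := by
  obtain ⟨z, hz, hv⟩ := h
  exact hz (mem_corners_of_mem_openStar hv (toReal_mem_openStar v))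

theorem starConvex_openStar_inter (S : Set (Lat D)) (v : Lat D) :
    StarConvex ℝ (toReal v) (openStar v ∩ realization S) := by
  rw [starConvex_iff_segment_subset]
  rintro p ⟨hp, z, hz, hpz⟩
  have hv := toReal_mem_cube (mem_corners_of_mem_openStar hpz hp)
  exact Set.subset_inter ((convex_openStar v).segment_subset (toReal_mem_openStar v) hp)
    (((convex_cube z).segment_subset hv hpz).trans (cube_subset_realization hz))

theorem exists_corners_of_segment_mem {S : Set (Lat D)} {v w : Lat D}
    (hadj : (latGraph D).Adj v w)
    (h : ∀ t, Path.segment (toReal v) (toReal w) t ∈ realization S) :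
    ∃ c, corners c ⊆ S ∧ v ∈ corners c ∧ w ∈ corners c := by
  -- The midpoint of an edge lies in the open stars of both its ends.
  have hmid : (2⁻¹ : ℝ) ∈ I := ⟨by norm_num, by norm_num⟩
  obtain ⟨c, hc, hcube⟩ := h ⟨2⁻¹, hmid⟩
  have hpoint (i : Fin D) :
      Path.segment (toReal v) (toReal w) ⟨2⁻¹, hmid⟩ i = (v i + w i : ℝ) / 2 := by
    simp only [Path.segment_apply, AffineMap.lineMap_apply_module', Pi.add_apply, Pi.smul_apply,
      Pi.sub_apply, toReal, smul_eq_mul]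
    ring
  have hdist (i : Fin D) : |(w i : ℝ) - v i| ≤ 1 := by
    exact_mod_cast unitSteps_subset_box hadj i
  refine ⟨c, hc, mem_corners_of_mem_openStar hcube fun i _ => ?_,
    mem_corners_of_mem_openStar hcube fun i _ => ?_⟩ <;>
  · have := abs_le.mp (hdist i)
    rw [hpoint]
    constructor <;> linarith

end Stars

section Cellular

open Path

variable {D : ℕ} {S : Set (Lat D)}

/-- The piecewise linear path of the trail `ζ` stays in the realization of `S`. -/
def Trail.RunsIn {y z : Lat D} (ζ : Trail y z) (S : Set (Lat D)) : Prop :=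
  ∀ t, ζ.path t ∈ realization S

namespace Trail.RunsIn

variable {x y z : Lat D}

theorem start_mem {ζ : Trail y z} (h : ζ.RunsIn S) : toReal y ∈ realization S :=
  ζ.path.source ▸ h 0

theorem end_mem {ζ : Trail y z} (h : ζ.RunsIn S) : toReal z ∈ realization S :=
  ζ.path.target ▸ h 1

theorem inSet {ζ : Trail y z} (h : ζ.RunsIn S) : ζ.InSet S := by
  induction ζ with
  | nil => simpa only [Trail.InSet, SimpleGraph.Walk.support_nil, List.mem_singleton,
      forall_eq] using mem_of_toReal_mem_realization h.start_mem
  | cons hadj ζ ih =>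
    exact (inSet_cons_iff hadj ζ).mpr ⟨mem_of_toReal_mem_realization h.start_mem,
      ih (forall_trans_mem_iff.mp h).2⟩

theorem append {ζ : Trail x y} {ξ : Trail y z} (hζ : ζ.RunsIn S) (hξ : ξ.RunsIn S) :
    Trail.RunsIn (SimpleGraph.Walk.append ζ ξ : Trail x z) S := by
  induction ζ with
  | nil => exact hξ
  | cons _ _ ih =>
    have hsplit := forall_trans_mem_iff.mp hζ
    exact forall_trans_mem_iff.mpr ⟨hsplit.1, ih hsplit.2 hξ⟩

/-- The homotopy class, relative to the end points and within the realization of `S`, of the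
piecewise linear path of a trail. -/
noncomputable def pathClass {ζ : Trail y z} (h : ζ.RunsIn S) :
    Homotopic.Quotient (⟨toReal y, h.start_mem⟩ : realization S) ⟨toReal z, h.end_mem⟩ :=
  .mk (pathInto ζ.path h h.start_mem h.end_mem)

theorem pathClass_nil (h : Trail.RunsIn (.nil : Trail y y) S) :
    h.pathClass = .refl _ :=
  rfl

theorem pathClass_cons {hadj : (latGraph D).Adj x y} {ζ : Trail y z}
    (h : Trail.RunsIn (.cons hadj ζ : Trail x z) S)
    (hstep : ∀ t, Path.segment (toReal x) (toReal y) t ∈ realization S) (hζ : ζ.RunsIn S) :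
    h.pathClass =
      (Homotopic.Quotient.mk (pathInto _ hstep h.start_mem hζ.start_mem)).trans hζ.pathClass :=
  congrArg Homotopic.Quotient.mk (pathInto_trans _ _ hstep hζ h _ _ _)

theorem pathClass_append {ζ : Trail x y} {ξ : Trail y z} (hζ : ζ.RunsIn S) (hξ : ξ.RunsIn S) :
    (hζ.append hξ).pathClass = hζ.pathClass.trans hξ.pathClass := by
  induction ζ with
  | nil => exact (Homotopic.Quotient.refl_trans _).symm
  | cons _ _ ih =>
    have hsplit := forall_trans_mem_iff.mp hζ
    rw [pathClass_cons hζ hsplit.1 hsplit.2, Homotopic.Quotient.trans_assoc, ← ih hsplit.2 hξ]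
    exact pathClass_cons _ hsplit.1 _

end Trail.RunsIn

theorem Trail.path_mem_cube {y z c : Lat D} {ζ : Trail y z} (h : ζ.InSet (corners c)) (t : I) :
    ζ.path t ∈ cube c := by
  induction ζ generalizing t with
  | nil => exact toReal_mem_cube h.start_mem
  | cons hadj ζ ih =>
    rw [Trail.inSet_cons_iff] at h
    exact forall_trans_mem_iff.mpr ⟨segment_mem_of_convex (convex_cube c) (toReal_mem_cube h.1)
      (toReal_mem_cube h.2.start_mem), ih h.2⟩ t

theorem segment_mem_realization {v : Lat D} {p : realization S} (h : p.1 ∈ openStar v) (t : I) :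
    Path.segment p.1 (toReal v) t ∈ realization S := by
  obtain ⟨z, hz, hpz⟩ := p.2
  exact cube_subset_realization hz (segment_mem_of_convex (convex_cube z) hpz
    (toReal_mem_cube (mem_corners_of_mem_openStar hpz h)) t)

theorem toReal_mem_realization {v : Lat D} {p : realization S} (h : p.1 ∈ openStar v) :
    toReal v ∈ realization S :=
  (Path.segment p.1 (toReal v)).target ▸ segment_mem_realization h 1

/-- The segment, within the realization of `S`, from a point to the centre of an open star around
it. -/
noncomputable def toCentre {v : Lat D} {p : realization S} (h : p.1 ∈ openStar v) :
    Path p ⟨toReal v, toReal_mem_realization h⟩ :=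
  pathInto (Path.segment p.1 (toReal v)) (segment_mem_realization h) p.2 _

theorem toCentre_mem_cube {v z : Lat D} {p : realization S} (h : p.1 ∈ openStar v)
    (hz : p.1 ∈ cube z) (t : I) : (toCentre h t).1 ∈ cube z :=
  segment_mem_of_convex (convex_cube z) hz
    (toReal_mem_cube (mem_corners_of_mem_openStar hz h)) t

theorem toCentre_mem_openStar {v : Lat D} {p : realization S} (h : p.1 ∈ openStar v) (t : I) :
    (toCentre h t).1 ∈ openStar v :=
  segment_mem_of_convex (convex_openStar v) h (toReal_mem_openStar v) t

theorem exists_trail_toCentre {v w : Lat D} {p : realization S} (hv : p.1 ∈ openStar v)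
    (hw : p.1 ∈ openStar w) :
    ∃ (ζ : Trail v w) (h : ζ.RunsIn S),
      (Homotopic.Quotient.mk (toCentre hv)).trans h.pathClass = .mk (toCentre hw) := by
  obtain ⟨c, hc, hpc⟩ := id p.2
  obtain ⟨ζ, hζ⟩ := exists_trail_inSet_corners (mem_corners_of_mem_openStar hpc hv)
    (mem_corners_of_mem_openStar hpc hw)
  have hcube := Trail.path_mem_cube hζ
  refine ⟨ζ, fun t => cube_subset_realization hc (hcube t), ?_⟩
  exact Homotopic.Quotient.eq.mpr <|
    homotopic_of_starConvex ((convex_cube c).starConvex hpc) (cube_subset_realization hc)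
      (forall_trans_mem_iff (W := {x : realization S | x.1 ∈ cube c}).mpr
        ⟨toCentre_mem_cube hv hpc, hcube⟩)
      (toCentre_mem_cube hw hpc)

theorem trans_toCentre_eq {u : Lat D} {p q : realization S} (γ : Path p q)
    (h : ∀ t, (γ t).1 ∈ openStar u) (hp : p.1 ∈ openStar u) (hq : q.1 ∈ openStar u) :
    (Homotopic.Quotient.mk γ).trans (.mk (toCentre hq)) = .mk (toCentre hp) := by
  rw [← Homotopic.Quotient.mk_trans]
  exact Homotopic.Quotient.eq.mpr <|
    homotopic_of_starConvex (starConvex_openStar_inter S u) Set.inter_subset_right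
      (forall_trans_mem_iff (W := {x : realization S | x.1 ∈ openStar u ∩ realization S}).mpr
        ⟨fun t => ⟨h t, Subtype.prop _⟩,
          fun t => ⟨toCentre_mem_openStar hq t, Subtype.prop _⟩⟩)
      fun t => ⟨toCentre_mem_openStar hp t, Subtype.prop _⟩

/-- A homotopy class of paths in the realization of `S` is cellular if it is the class of a trail,
once its end points are joined to nearby lattice points. Asking for this for all choices of these
lattice points makes the notion stable under composition. -/
def IsCellular {p q : realization S} (γ : Homotopic.Quotient p q) : Prop :=
  ∀ (v w : Lat D) (hv : p.1 ∈ openStar v) (hw : q.1 ∈ openStar w),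
    ∃ (ζ : Trail v w) (h : ζ.RunsIn S),
      γ.trans (.mk (toCentre hw)) = (Homotopic.Quotient.mk (toCentre hv)).trans h.pathClass

theorem IsCellular.trans {p q r : realization S} {γ : Homotopic.Quotient p q}
    {γ' : Homotopic.Quotient q r} (hγ : IsCellular γ) (hγ' : IsCellular γ') :
    IsCellular (γ.trans γ') := by
  intro v w hv hw
  obtain ⟨ζ, hζ, hγζ⟩ := hγ v _ hv (mem_openStar_floor q.1)
  obtain ⟨ξ, hξ, hγξ⟩ := hγ' _ w (mem_openStar_floor q.1) hw
  refine ⟨ζ.append ξ, hζ.append hξ, ?_⟩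
  rw [Homotopic.Quotient.trans_assoc, hγξ, ← Homotopic.Quotient.trans_assoc, hγζ,
    Homotopic.Quotient.trans_assoc, ← Trail.RunsIn.pathClass_append]

theorem isCellular_of_mem_openStar {u : Lat D} {p q : realization S} (γ : Path p q)
    (h : ∀ t, (γ t).1 ∈ openStar u) : IsCellular (Homotopic.Quotient.mk γ) := by
  intro v w hv hw
  have hp : p.1 ∈ openStar u := γ.source ▸ h 0
  have hq : q.1 ∈ openStar u := γ.target ▸ h 1
  obtain ⟨ζ, hζ, hpζ⟩ := exists_trail_toCentre hv hp
  obtain ⟨ξ, hξ, hqξ⟩ := exists_trail_toCentre hq hw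
  refine ⟨ζ.append ξ, hζ.append hξ, ?_⟩
  rw [← hqξ, ← Homotopic.Quotient.trans_assoc, trans_toCentre_eq γ h hp hq, ← hpζ,
    Homotopic.Quotient.trans_assoc, Trail.RunsIn.pathClass_append hζ hξ]

theorem isCellular {p q : realization S} (γ : Homotopic.Quotient p q) : IsCellular γ :=
  pathClass_induction (U := fun v : Lat D => {x : realization S | x.1 ∈ openStar v})
    (fun v => (isOpen_openStar v).preimage continuous_subtype_val)
    (fun x => ⟨_, mem_openStar_floor x.1⟩) (P := fun _ _ => IsCellular) IsCellular.trans
    (fun _ _ _ => isCellular_of_mem_openStar) γ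

theorem exists_pathClass_eq {y z : Lat D} {hy : toReal y ∈ realization S}
    {hz : toReal z ∈ realization S}
    (γ : Homotopic.Quotient (⟨toReal y, hy⟩ : realization S) ⟨toReal z, hz⟩) :
    ∃ (ζ : Trail y z) (h : ζ.RunsIn S), h.pathClass = γ := by
  obtain ⟨ζ, h, hγ⟩ := isCellular γ y z (toReal_mem_openStar y) (toReal_mem_openStar z)
  have hrefl {w : Lat D} (hw : toReal w ∈ realization S) :
      toCentre (p := (⟨toReal w, hw⟩ : realization S)) (toReal_mem_openStar w) = .refl _ := by
    ext t
    simp [toCentre, pathInto]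
  rw [hrefl, hrefl, Homotopic.Quotient.mk_refl, Homotopic.Quotient.mk_refl,
    Homotopic.Quotient.trans_refl, Homotopic.Quotient.refl_trans] at hγ
  exact ⟨ζ, h, hγ.symm⟩

end Cellular

/-- Locally constant transition functions with values in `G` over an open cover of `X`, that is, a
flat principal `G`-bundle over `X`. The transition functions are indexed by the pairs of members of
the cover only, so they are constant on each overlap. -/
structure FlatCocycle (ι X G : Type*) [TopologicalSpace X] [Group G] where
  chart : ι → Set X
  isOpen_chart : ∀ i, IsOpen (chart i)
  index : X → ι
  mem_chart_index : ∀ x, x ∈ chart (index x)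
  trans : ι → ι → G
  trans_mul_trans : ∀ i j k x, x ∈ chart i → x ∈ chart j → x ∈ chart k →
    trans j k * trans i j = trans i k

namespace FlatCocycle

variable {ι X G : Type*} [TopologicalSpace X] [Group G] [TopologicalSpace G]
  [DiscreteTopology G] (Φ : FlatCocycle ι X G)

/-- The covering space of `X` with fibre `G` glued from the transition functions. -/
def core : FiberBundleCore ι X G where
  baseSet := Φ.chart
  isOpen_baseSet := Φ.isOpen_chart
  indexAt := Φ.index
  mem_baseSet_at := Φ.mem_chart_index
  coordChange i j _ g := Φ.trans i j * g
  coordChange_self i x hx g := by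
    rw [mul_eq_left.mp (Φ.trans_mul_trans i i i x hx hx hx), one_mul]
  continuousOn_coordChange i j :=
    ((continuous_of_discreteTopology (f := fun g : G => Φ.trans i j * g)).comp
      continuous_snd).continuousOn
  coordChange_comp i j k x hx g := by
    rw [← mul_assoc, Φ.trans_mul_trans i j k x hx.1.1 hx.1.2 hx.2]

theorem isCoveringMap : IsCoveringMap Φ.core.proj :=
  IsCoveringMap.mk (f := Φ.core.proj) (fun _ => G) (fun x => Φ.core.localTrivAt x)
    fun x => Φ.core.mem_baseSet_at x

/-- The point over `p` with coordinate `g` in the chart `Φ.index p`. -/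
def fibrePt (p : X) (g : G) : Φ.core.proj ⁻¹' {p} := ⟨⟨p, g⟩, rfl⟩

theorem fibrePt_injective (p : X) : Function.Injective (Φ.fibrePt p) := fun _ _ h =>
  eq_of_heq (Bundle.TotalSpace.mk.inj (congrArg Subtype.val h)).2

theorem continuous_of_flat_section {Z : Type*} [TopologicalSpace Z] {γ : Z → X}
    (hγ : Continuous γ) (f : ι → G)
    (hf : ∀ z i j, γ z ∈ Φ.chart i → γ z ∈ Φ.chart j → Φ.trans i j * f i = f j) :
    Continuous fun z => (⟨γ z, f (Φ.index (γ z))⟩ : Φ.core.TotalSpace) := by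
  refine continuous_iff_continuousAt.mpr fun z₀ => ?_
  let e := Φ.core.localTrivAt (γ z₀)
  have hchart : ∀ᶠ z in nhds z₀, γ z ∈ Φ.chart (Φ.index (γ z₀)) :=
    hγ.continuousAt.preimage_mem_nhds ((Φ.isOpen_chart _).mem_nhds (Φ.mem_chart_index _))
  rw [e.toOpenPartialHomeomorph.continuousAt_iff_continuousAt_comp_left]
  · refine hγ.continuousAt.prodMk (continuousAt_const (y := f (Φ.index (γ z₀))) |>.congr ?_)
    filter_upwards [hchart] with z hz
    exact (hf z _ _ (Φ.mem_chart_index _) hz).symm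
  · exact hchart

theorem monodromy_mk_of_flat_section {p q : X} (γ : Path p q) (f : ι → G)
    (hf : ∀ t i j, γ t ∈ Φ.chart i → γ t ∈ Φ.chart j → Φ.trans i j * f i = f j) :
    Φ.isCoveringMap.monodromy (.mk γ) (Φ.fibrePt p (f (Φ.index p))) =
      Φ.fibrePt q (f (Φ.index q)) := by
  have hsource : (⟨γ 0, f (Φ.index (γ 0))⟩ : Φ.core.TotalSpace) = ⟨p, f (Φ.index p)⟩ := by
    rw [γ.source]
  have htarget : (⟨γ 1, f (Φ.index (γ 1))⟩ : Φ.core.TotalSpace) = ⟨q, f (Φ.index q)⟩ := by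
    rw [γ.target]
  have hlift := (Φ.isCoveringMap.eq_liftPath_iff (γ := (γ : C(I, X)))
    (e := ⟨p, f (Φ.index p)⟩) γ.source).mpr
      ⟨Φ.continuous_of_flat_section γ.continuous f hf, rfl, hsource⟩
  exact Subtype.ext ((congrFun hlift 1).symm.trans htarget)

end FlatCocycle

section Monodromy

variable {D : ℕ} {S : Set (Lat D)} {G : Type*} [Group G]

/-- The flat bundle over the realization of `S` whose charts are the open stars, for transition
elements between lattice points that are compatible on each cube. -/
noncomputable def starCocycle (T : Lat D → Lat D → G)
    (hT : ∀ z, corners z ⊆ S → ∀ u ∈ corners z, ∀ v ∈ corners z, ∀ w ∈ corners z,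
      T v w * T u v = T u w) : FlatCocycle (Lat D) (realization S) G where
  chart v := {p | p.1 ∈ openStar v}
  isOpen_chart v := (isOpen_openStar v).preimage continuous_subtype_val
  index p i := ⌊p.1 i⌋
  mem_chart_index p := mem_openStar_floor p.1
  trans := T
  trans_mul_trans u v w p hu hv hw := by
    obtain ⟨z, hz, hp⟩ := p.2
    exact hT z hz u (mem_corners_of_mem_openStar hp hu) v (mem_corners_of_mem_openStar hp hv)
      w (mem_corners_of_mem_openStar hp hw)

variable [TopologicalSpace G] [DiscreteTopology G] {T : Lat D → Lat D → G}
  {hT : ∀ z, corners z ⊆ S → ∀ u ∈ corners z, ∀ v ∈ corners z, ∀ w ∈ corners z,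
    T v w * T u v = T u w}

theorem starCocycle_monodromy_segment {v w : Lat D} (hadj : (latGraph D).Adj v w)
    (h : ∀ t, Path.segment (toReal v) (toReal w) t ∈ realization S)
    (hv : toReal v ∈ realization S) (hw : toReal w ∈ realization S) (g : G) :
    (starCocycle T hT).isCoveringMap.monodromy (.mk (pathInto _ h hv hw))
      ((starCocycle T hT).fibrePt ⟨toReal v, hv⟩ g) =
        (starCocycle T hT).fibrePt ⟨toReal w, hw⟩ (T v w * g) := by
  obtain ⟨c, hc, hvc, hwc⟩ := exists_corners_of_segment_mem hadj h
  have hcube := segment_mem_of_convex (convex_cube c) (toReal_mem_cube hvc) (toReal_mem_cube hwc)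
  have hvv : T v v = 1 := mul_eq_left.mp (hT c hc v hvc v hvc v hvc)
  have hindex {u : Lat D} (hu : toReal u ∈ realization S) :
      (starCocycle T hT).index ⟨toReal u, hu⟩ = u := floor_toReal u
  have hflat := (starCocycle T hT).monodromy_mk_of_flat_section (pathInto _ h hv hw)
    (fun u => T v u * g) fun t i j hi hj => by
      rw [← mul_assoc]
      exact congrArg (· * g) (hT c hc v hvc i (mem_corners_of_mem_openStar (hcube t) hi) j
        (mem_corners_of_mem_openStar (hcube t) hj))
  rwa [hindex, hindex, hvv, one_mul] at hflat

theorem starCocycle_monodromy_pathClass {A : Type*} {s : ℕ} {c : Lat D → (box D s → A) → G}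
    {a : Lat D → A} (hTc : ∀ v ∈ S, ∀ w, w - v ∈ unitSteps D → T v w = c (w - v) (block s a v))
    {y z : Lat D} {ζ : Trail y z} (h : ζ.RunsIn S) (g : G) :
    (starCocycle T hT).isCoveringMap.monodromy h.pathClass
      ((starCocycle T hT).fibrePt ⟨toReal y, h.start_mem⟩ g) =
        (starCocycle T hT).fibrePt ⟨toReal z, h.end_mem⟩ (Trail.value c a ζ * g) := by
  induction ζ generalizing g with
  | nil =>
    rw [Trail.RunsIn.pathClass_nil, Trail.value, one_mul]
    exact congrFun (starCocycle T hT).isCoveringMap.monodromy_refl _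
  | @cons y x z hadj ζ ih =>
    have hsplit := forall_trans_mem_iff.mp h
    rw [Trail.RunsIn.pathClass_cons h hsplit.1 hsplit.2, IsCoveringMap.monodromy_trans_apply,
      starCocycle_monodromy_segment hadj, ih hsplit.2, Trail.value, mul_assoc,
      hTc y h.inSet.start_mem x hadj]

variable {A : Type*} [TopologicalSpace A] {𝔄 : Subshift A (Lat D)} {a : Lat D → A}
  {C : Lat D → 𝔄.carrier → G} {s R : ℕ} {c : Lat D → (box D s → A) → G}

theorem value_eq_of_pathClass_eq (hc : IsLocalRule 𝔄 C s c) (hC : C ∈ cocycles 𝔄 G)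
    (hs : s < R) (hS : S ⊆ unflawed 𝔄 a R) {y z : Lat D} {ζ ξ : Trail y z} (hζ : ζ.RunsIn S)
    (hξ : ξ.RunsIn S) (h : hζ.pathClass = hξ.pathClass) :
    Trail.value c a ζ = Trail.value c a ξ := by
  obtain ⟨p, hp⟩ := exists_local_model (Nat.zero_lt_of_lt hs) ⟨y, hS hζ.inSet.start_mem⟩
  let T (u v : Lat D) : G := C (v - u) (p u)
  have hT : ∀ x, corners x ⊆ S → ∀ u ∈ corners x, ∀ v ∈ corners x, ∀ w ∈ corners x,
      T v w * T u v = T u w := by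
    intro x hx u hu v hv w hw
    obtain ⟨η, hη⟩ := exists_trail_inSet_corners hv hw
    have hmodel : C (w - v) (p v) = C (w - v) (shiftOn 𝔄 (v - u) (p u)) := by
      rw [← hc.value_eq_of_corners hC hs (hp u (hS (hx hu))) hu hη,
        hc.value_eq_of_corners hC hs (hp v (hS (hx hv))) hv hη, sub_self, shiftOn_zero]
    change C (w - v) (p v) * C (v - u) (p u) = C (w - u) (p u)
    rw [hmodel, ← hC.2, sub_add_sub_cancel]
  have hTc : ∀ v ∈ S, ∀ w, w - v ∈ unitSteps D → T v w = c (w - v) (block s a v) := by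
    intro v hv w he
    rw [← block_eq_of_le hs.le (hp v (hS hv)), hc _ he]
  have hmonodromy {ζ : Trail y z} (h : ζ.RunsIn S) :=
    starCocycle_monodromy_pathClass (hT := hT) hTc h 1
  have hfibre := (hmonodromy hζ).symm.trans (h ▸ hmonodromy hξ)
  simpa only [mul_one] using (starCocycle T hT).fibrePt_injective _ hfibre

end Monodromy

namespace Trail.RunsIn

variable {D : ℕ} {S T : Set (Lat D)} {y z : Lat D} {ζ : Trail y z}

theorem mono (h : ζ.RunsIn S) (hST : S ⊆ T) : ζ.RunsIn T :=
  fun t => realization_mono hST (h t)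

end Trail.RunsIn

namespace ProperBaseRay

open Path

variable {D : ℕ} {A : Type*} [TopologicalSpace A] {𝔄 : Subshift A (Lat D)} {a : Lat D → A}
  {Y : Set (Lat D)} {ω : ProperBaseRay 𝔄 a Y} {r₀ : ℕ}

variable (ω) in
theorem exists_basing {R : ℕ} (hR : r₀ < R) (t₀ : ℝ≥0) :
    ∃ β : ω.Basing r₀, β.idx.r = R ∧ t₀ ≤ β.idx.t := by
  obtain ⟨t₁, ht₁⟩ := eventually_atTop.mp (ω.eventually_mem R)
  let i : ω.Index r₀ := ⟨R, max t₀ t₁, hR, fun u hu => ht₁ u ((le_max_right _ _).trans hu)⟩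
  exact ⟨⟨i, _, _, toCentre (mem_openStar_floor i.base.1)⟩, rfl, le_max_left _ _⟩

theorem represents_iff {β : ω.Basing r₀} {ζ : Trail β.y β.y} {x : ω.properPi1 r₀} :
    Represents β ζ x ↔ ∃ h : ζ.RunsIn (Y ∩ unflawed 𝔄 a β.idx.r),
      (Homotopic.Quotient.mk β.γ).trans h.pathClass =
        (FundamentalGroup.toPath (x.1 β.idx)).trans (.mk β.γ) := by
  have hconj (p : Path (⟨toReal β.y, β.mem⟩ : region 𝔄 a Y β.idx.r) ⟨toReal β.y, β.mem⟩) :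
      FundamentalGroup.fromPath (.mk ((β.γ.trans p).trans β.γ.symm)) = x.1 β.idx ↔
        (Homotopic.Quotient.mk β.γ).trans (.mk p) =
          (FundamentalGroup.toPath (x.1 β.idx)).trans (.mk β.γ) := by
    rw [Homotopic.Quotient.mk_trans, Homotopic.Quotient.mk_trans, Homotopic.Quotient.mk_symm]
    exact trans_symm_eq_iff
  constructor
  · rintro ⟨-, p, hp, hx⟩
    have h : ζ.RunsIn (Y ∩ unflawed 𝔄 a β.idx.r) := fun t => hp t ▸ (p t).2
    have hpath : pathInto ζ.path h β.mem β.mem = p :=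
      Path.ext (funext fun t => Subtype.ext (hp t).symm)
    exact ⟨h, (congrArg _ (congrArg Homotopic.Quotient.mk hpath)).trans ((hconj p).mp hx)⟩
  · rintro ⟨h, hx⟩
    exact ⟨h.inSet, pathInto ζ.path h β.mem β.mem, fun _ => rfl, (hconj _).mpr hx⟩

theorem exists_represents (β : ω.Basing r₀) (x : ω.properPi1 r₀) :
    ∃ ζ : Trail β.y β.y, Represents β ζ x := by
  obtain ⟨ζ, h, hζ⟩ := exists_pathClass_eq ((Homotopic.Quotient.symm (.mk β.γ)).trans
    ((FundamentalGroup.toPath (x.1 β.idx)).trans (.mk β.γ)))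
  refine ⟨ζ, represents_iff.mpr ⟨h, ?_⟩⟩
  rw [hζ]
  exact trans_symm_trans_cancel _ _

theorem Represents.append {β : ω.Basing r₀} {ζ ξ : Trail β.y β.y} {x y : ω.properPi1 r₀}
    (hζ : Represents β ζ x) (hξ : Represents β ξ y) : Represents β (ξ.append ζ) (x * y) := by
  obtain ⟨h, hx⟩ := represents_iff.mp hζ
  obtain ⟨h', hy⟩ := represents_iff.mp hξ
  refine represents_iff.mpr ⟨h'.append h, ?_⟩
  rw [Trail.RunsIn.pathClass_append]
  exact (square_trans hy.symm hx.symm).symm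

theorem Index.seg_trans_map {i j : ω.Index r₀} (hr : i.r ≤ j.r) (ht : i.t ≤ j.t)
    (x : j.group) :
    (Homotopic.Quotient.mk (i.seg j.t ht)).trans
      ((FundamentalGroup.toPath x).map (.inclusion (region_anti 𝔄 a Y hr))) =
        (FundamentalGroup.toPath (i.bond j hr ht x)).trans (.mk (i.seg j.t ht)) := by
  refine trans_symm_eq_iff.mp ((Homotopic.Quotient.trans_assoc _ _ _).trans ?_)
  change _ = Homotopic.Quotient.trans (.symm (.mk (i.seg j.t ht).symm)) _
  rw [← Homotopic.Quotient.mk_symm, Path.symm_symm]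
  rfl

/-- The class of paths joining the base point of `β` to the lattice point of a later basing `β'`,
along the ray and then along the path of `β'`. -/
noncomputable def connectingClass (β β' : ω.Basing r₀) (hr : β.idx.r ≤ β'.idx.r)
    (ht : β.idx.t ≤ β'.idx.t) :
    Homotopic.Quotient β.idx.base ⟨toReal β'.y, region_anti 𝔄 a Y hr β'.mem⟩ :=
  (Homotopic.Quotient.mk (β.idx.seg β'.idx.t ht)).trans
    ((Homotopic.Quotient.mk β'.γ).map (.inclusion (region_anti 𝔄 a Y hr)))

theorem Represents.connectingClass_trans {β β' : ω.Basing r₀} (hr : β.idx.r ≤ β'.idx.r)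
    (ht : β.idx.t ≤ β'.idx.t) {ζ : Trail β'.y β'.y} {x : ω.properPi1 r₀}
    (hζ : Represents β' ζ x) :
    ∃ h : ζ.RunsIn (Y ∩ unflawed 𝔄 a β.idx.r),
      (connectingClass β β' hr ht).trans h.pathClass =
        (FundamentalGroup.toPath (x.1 β.idx)).trans (connectingClass β β' hr ht) := by
  obtain ⟨h, hx⟩ := represents_iff.mp hζ
  refine ⟨h.mono (Set.inter_subset_inter_right Y (unflawed_anti 𝔄 a hr)), ?_⟩
  have hseg := Index.seg_trans_map hr ht (x.1 β'.idx)
  rw [x.2 β.idx β'.idx hr ht] at hseg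
  exact square_trans hseg (square_map (.inclusion (region_anti 𝔄 a Y hr)) hx)

theorem exists_connecting_trail (β β' : ω.Basing r₀) (hr : β.idx.r ≤ β'.idx.r)
    (ht : β.idx.t ≤ β'.idx.t) :
    ∃ (η : Trail β.y β'.y) (hη : η.RunsIn (Y ∩ unflawed 𝔄 a β.idx.r)),
      ∀ (x : ω.properPi1 r₀) (ζ : Trail β.y β.y) (ζ' : Trail β'.y β'.y),
        Represents β ζ x → Represents β' ζ' x →
          ∃ (h : ζ.RunsIn (Y ∩ unflawed 𝔄 a β.idx.r)) (h' : ζ'.RunsIn (Y ∩ unflawed 𝔄 a β.idx.r)),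
            (h.append hη).pathClass = (hη.append h').pathClass := by
  obtain ⟨η, hη, hclass⟩ := exists_pathClass_eq
    ((Homotopic.Quotient.symm (.mk β.γ)).trans (connectingClass β β' hr ht))
  refine ⟨η, hη, fun x ζ ζ' hζ hζ' => ?_⟩
  obtain ⟨h, hx⟩ := represents_iff.mp hζ
  obtain ⟨h', hx'⟩ := hζ'.connectingClass_trans hr ht
  refine ⟨h, h', ?_⟩
  rw [Trail.RunsIn.pathClass_append h hη, Trail.RunsIn.pathClass_append hη h', hclass]
  exact (square_trans (square_symm hx) hx').symm

theorem exists_value_eq_conj {G : Type*} [Group G] [TopologicalSpace G] [DiscreteTopology G]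
    {C : Lat D → 𝔄.carrier → G} (hC : C ∈ cocycles 𝔄 G) {s : ℕ}
    {c : Lat D → (box D s → A) → G} (hc : IsLocalRule 𝔄 C s c) (β β' : ω.Basing r₀)
    (hs : s < β.idx.r) (hr : β.idx.r ≤ β'.idx.r) (ht : β.idx.t ≤ β'.idx.t) :
    ∃ g : G, ∀ (x : ω.properPi1 r₀) (ζ : Trail β.y β.y) (ζ' : Trail β'.y β'.y),
      Represents β ζ x → Represents β' ζ' x →
        Trail.value c a ζ = g * Trail.value c a ζ' * g⁻¹ := by
  obtain ⟨η, hη, hclass⟩ := exists_connecting_trail β β' hr ht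
  refine ⟨(Trail.value c a η)⁻¹, fun x ζ ζ' hζ hζ' => ?_⟩
  obtain ⟨h, h', heq⟩ := hclass x ζ ζ' hζ hζ'
  have hvalue := value_eq_of_pathClass_eq hc hC hs Set.inter_subset_right _ _ heq
  rw [Trail.value_append, Trail.value_append] at hvalue
  rw [mul_assoc, inv_inv, ← hvalue, inv_mul_cancel_left]

end ProperBaseRay

open ProperBaseRay

section Residues

variable {D : ℕ} {A : Type*} [TopologicalSpace A] {𝔄 : Subshift A (Lat D)} {a : Lat D → A}
  {Y : Set (Lat D)} {ω : ProperBaseRay 𝔄 a Y} {r₀ : ℕ}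

section Values

variable {G : Type*} [Group G] {s s' : ℕ} {c : Lat D → (box D s → A) → G}
  {c' : Lat D → (box D s' → A) → G} {β β' : ω.Basing r₀} {ρ ρ' : ω.properPi1 r₀ → G}

/-- `ρ x` is the value of the local rule `c` along the closed trails representing `x` in the
basing `β`, up to a conjugation independent of `x` and of the trail: the instance of `IsResidue`
for a single local rule and a single basing. -/
def HasValues (β : ω.Basing r₀) (c : Lat D → (box D s → A) → G) (ρ : ω.properPi1 r₀ → G) : Prop :=
  ∃ g : G, ∀ (x : ω.properPi1 r₀) (ζ : Trail β.y β.y),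
    Represents β ζ x → ζ.value c a = g * ρ x * g⁻¹

theorem HasValues.of_conj (h : HasValues β' c' ρ)
    (hconj : ∃ g : G, ∀ (x : ω.properPi1 r₀) (ζ : Trail β.y β.y) (ζ' : Trail β'.y β'.y),
      Represents β ζ x → Represents β' ζ' x →
        ζ.value c a = g * ζ'.value c' a * g⁻¹) : HasValues β c ρ := by
  obtain ⟨g, hg⟩ := h
  obtain ⟨f, hf⟩ := hconj
  refine ⟨f * g, fun x ζ hζ => ?_⟩
  obtain ⟨ζ', hζ'⟩ := exists_represents β' x
  rw [hf x ζ ζ' hζ hζ', hg x ζ' hζ']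
  group

theorem HasValues.unique (h : HasValues β c ρ) (h' : HasValues β c ρ') :
    ∃ g : G, ∀ x, ρ' x = g * ρ x * g⁻¹ := by
  obtain ⟨g, hg⟩ := h
  obtain ⟨g', hg'⟩ := h'
  refine ⟨g'⁻¹ * g, fun x => ?_⟩
  obtain ⟨ζ, hζ⟩ := exists_represents β x
  have hvalue := (hg' x ζ hζ).symm.trans (hg x ζ hζ)
  calc ρ' x = g'⁻¹ * (g' * ρ' x * g'⁻¹) * g' := by group
    _ = g'⁻¹ * g * ρ x * (g'⁻¹ * g)⁻¹ := by rw [hvalue]; group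

theorem HasValues.map_mul (h : HasValues β c ρ) (x y : ω.properPi1 r₀) :
    ρ (x * y) = ρ x * ρ y := by
  obtain ⟨g, hg⟩ := h
  obtain ⟨ζ, hζ⟩ := exists_represents β x
  obtain ⟨ξ, hξ⟩ := exists_represents β y
  have hvalue := hg _ _ (hζ.append hξ)
  rw [Trail.value_append, hg x ζ hζ, hg y ξ hξ] at hvalue
  exact (conj_injective (conj_mul.symm.trans hvalue)).symm

theorem HasValues.eq_one (h : HasValues β c ρ) (x : ω.properPi1 r₀)
    (hone : ∀ ζ : Trail β.y β.y, Represents β ζ x → ζ.value c a = 1) : ρ x = 1 := by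
  obtain ⟨g, hg⟩ := h
  obtain ⟨ζ, hζ⟩ := exists_represents β x
  exact conj_eq_one_iff.mp ((hg x ζ hζ).symm.trans (hone ζ hζ))

end Values

theorem HasValues.value_eq {G : Type*} [CommGroup G] {s : ℕ} {c : Lat D → (box D s → A) → G}
    {β : ω.Basing r₀} {ρ : ω.properPi1 r₀ → G} (h : HasValues β c ρ) {x : ω.properPi1 r₀}
    {ζ : Trail β.y β.y} (hζ : Represents β ζ x) : ζ.value c a = ρ x := by
  obtain ⟨g, hg⟩ := h
  rw [hg x ζ hζ, mul_comm g, mul_inv_cancel_right]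

theorem IsResidue.eq_one_of_mem_trivialCocycles {G : Type*} [CommGroup G] [TopologicalSpace G]
    [DiscreteTopology G] {C : cocycleGroup 𝔄 G} (hC : C ∈ trivialCocycles 𝔄 G)
    {ρ : ω.properPi1 r₀ → G} (h : IsResidue ω (Quotient.mk (cohomSetoid 𝔄 G) ⟨C.1, C.2⟩) ρ)
    (x : ω.properPi1 r₀) : ρ x = 1 := by
  obtain ⟨f, hf⟩ := hC
  let F : cocycles 𝔄 G := ⟨fun z _ => f (.ofAdd z),
    (continuous_of_discreteTopology (f := fun z : Lat D => f (.ofAdd z))).comp continuous_fst,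
    fun y z _ => f.map_mul (.ofAdd y) (.ofAdd z)⟩
  have hrule : IsLocalRule 𝔄 F.1 0 fun z _ => f (.ofAdd z) := fun _ _ _ => rfl
  obtain ⟨β, hβ, -⟩ := exists_basing ω r₀.lt_succ_self 0
  have hvalues := h F (Quotient.sound hf) 0 _ hrule β (by omega)
  refine HasValues.eq_one hvalues x fun ζ _ => ?_
  rw [Trail.value_eq_of_monoidHom, sub_self, ofAdd_zero, map_one]

variable [CompactSpace A] [T2Space A]

section Group

variable {G : Type*} [Group G] [TopologicalSpace G] [DiscreteTopology G]

theorem HasValues.of_cohomologous {C C' : Lat D → 𝔄.carrier → G} (hC : C ∈ cocycles 𝔄 G)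
    (hC' : C' ∈ cocycles 𝔄 G) (hcohom : Cohomologous 𝔄 C C') {s s' : ℕ}
    {c : Lat D → (box D s → A) → G} {c' : Lat D → (box D s' → A) → G}
    (hc : IsLocalRule 𝔄 C s c) (hc' : IsLocalRule 𝔄 C' s' c') {β β' : ω.Basing r₀}
    (hs : s < β.idx.r) (hs' : s' < β'.idx.r) {ρ : ω.properPi1 r₀ → G} (h : HasValues β c ρ) :
    HasValues β' c' ρ := by
  -- Both basings are compared with a common later one, on whose range the values of the two rules
  -- differ by a transfer function.
  obtain ⟨R, ⟨f, hf⟩, hr, hβ, hβ'⟩ := ((hcohom.eventually_value_eq hc hc' a).and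
    ((eventually_gt_atTop r₀).and
      ((eventually_ge_atTop β.idx.r).and (eventually_ge_atTop β'.idx.r)))).exists
  obtain ⟨β'', rfl, ht⟩ := exists_basing ω hr (max β.idx.t β'.idx.t)
  obtain ⟨g, hg⟩ := exists_value_eq_conj hC hc β β'' hs hβ ((le_max_left _ _).trans ht)
  obtain ⟨g', hg'⟩ := exists_value_eq_conj hC' hc' β' β'' hs' hβ' ((le_max_right _ _).trans ht)
  refine h.of_conj ⟨g' * f β''.y * g⁻¹, fun x ζ' ζ hζ' hζ => ?_⟩
  obtain ⟨ξ, hξ⟩ := exists_represents β'' x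
  rw [hg' x ζ' ξ hζ' hξ, hf _ _ ξ (hξ.1.mono Set.inter_subset_right), hg x ζ ξ hζ hξ]
  group

theorem isResidue_iff {C : cocycles 𝔄 G} {s : ℕ} {c : Lat D → (box D s → A) → G}
    (hc : IsLocalRule 𝔄 C.1 s c) {β : ω.Basing r₀} (hs : s < β.idx.r)
    {ρ : ω.properPi1 r₀ → G} :
    IsResidue ω (Quotient.mk (cohomSetoid 𝔄 G) C) ρ ↔ HasValues β c ρ :=
  ⟨fun h => h C rfl s c hc β hs, fun h C' hC' _ _ hc' _ hs' =>
    h.of_cohomologous C.2 C'.2 (Quotient.exact hC'.symm) hc hc' hs hs'⟩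

variable (ω r₀) in
theorem exists_isLocalRule_basing (C : cocycles 𝔄 G) (n : ℕ) :
    ∃ (s : ℕ) (c : Lat D → (box D s → A) → G) (β : ω.Basing r₀),
      IsLocalRule 𝔄 C.1 s c ∧ s + n < β.idx.r := by
  obtain ⟨s, c, hc⟩ := (eventually_exists_isLocalRule C.2).exists
  obtain ⟨β, hβ, -⟩ := exists_basing ω (by omega : r₀ < r₀ + s + n + 1) 0
  exact ⟨s, c, β, hc, by omega⟩

variable (ω r₀) in
theorem exists_isResidue (κ : H1 𝔄 G) : ∃ ρ : ω.properPi1 r₀ → G, IsResidue ω κ ρ := by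
  induction κ using Quotient.ind with | _ C => ?_
  obtain ⟨s, c, β, hc, hs⟩ := exists_isLocalRule_basing ω r₀ C 0
  choose ζ hζ using exists_represents β
  refine ⟨fun x => (ζ x).value c a, (isResidue_iff hc hs).mpr ?_⟩
  obtain ⟨g, hg⟩ := exists_value_eq_conj C.2 hc β β hs le_rfl le_rfl
  exact ⟨g, fun x ξ hξ => hg x ξ (ζ x) hξ (hζ x)⟩

variable {κ : H1 𝔄 G} {ρ ρ' : ω.properPi1 r₀ → G}

theorem IsResidue.unique (h : IsResidue ω κ ρ) (h' : IsResidue ω κ ρ') :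
    ∃ g : G, ∀ x, ρ' x = g * ρ x * g⁻¹ := by
  induction κ using Quotient.ind with | _ C => ?_
  obtain ⟨s, c, β, hc, hs⟩ := exists_isLocalRule_basing ω r₀ C 0
  exact ((isResidue_iff hc hs).mp h).unique ((isResidue_iff hc hs).mp h')

theorem IsResidue.map_mul (h : IsResidue ω κ ρ) (x y : ω.properPi1 r₀) :
    ρ (x * y) = ρ x * ρ y := by
  induction κ using Quotient.ind with | _ C => ?_
  obtain ⟨s, c, β, hc, hs⟩ := exists_isLocalRule_basing ω r₀ C 0
  exact ((isResidue_iff hc hs).mp h).map_mul x y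

theorem IsResidue.map_one (h : IsResidue ω κ ρ) : ρ 1 = 1 := by
  have hmul := h.map_mul 1 1
  rwa [mul_one, left_eq_mul] at hmul

theorem IsResidue.eq_one_of_isRemovable (h : IsResidue ω κ ρ) (ha : IsRemovable 𝔄 a)
    (x : ω.properPi1 r₀) : ρ x = 1 := by
  induction κ using Quotient.ind with | _ C => ?_
  obtain ⟨r, hr, a', ha', heq⟩ := ha
  obtain ⟨s, c, β, hc, hs⟩ := exists_isLocalRule_basing ω r₀ C r
  refine ((isResidue_iff hc (by omega : s < β.idx.r)).mp h).eq_one x fun ζ hζ => ?_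
  have hblock : ∀ v ∈ SimpleGraph.Walk.support ζ, block s a v = block s a' (v - 0) :=
    fun v hv => by
      rw [sub_zero, block_eq_iff]
      exact fun u hu => (heq _ (add_mem_unflawed hr
        (unflawed_anti 𝔄 a (by omega : s + r ≤ β.idx.r) (hζ.1 v hv).2) hu)).symm
  rw [hc.value_eq C.2 (p := ⟨a', ha'⟩) ζ hblock, sub_self, cocycle_zero C.2]

end Group

section CommGroup

variable {G : Type*} [CommGroup G] [TopologicalSpace G] [DiscreteTopology G]

theorem IsResidue.eq {κ : H1 𝔄 G} {ρ ρ' : ω.properPi1 r₀ → G} (h : IsResidue ω κ ρ)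
    (h' : IsResidue ω κ ρ') : ρ' = ρ := by
  obtain ⟨g, hg⟩ := h.unique h'
  exact funext fun x => by rw [hg, mul_comm g, mul_inv_cancel_right]

theorem IsResidue.mul {C C' : cocycleGroup 𝔄 G} {ρ ρ' ρ'' : ω.properPi1 r₀ → G}
    (h : IsResidue ω (Quotient.mk (cohomSetoid 𝔄 G) ⟨C.1, C.2⟩) ρ)
    (h' : IsResidue ω (Quotient.mk (cohomSetoid 𝔄 G) ⟨C'.1, C'.2⟩) ρ')
    (h'' : IsResidue ω (Quotient.mk (cohomSetoid 𝔄 G) ⟨(C * C').1, (C * C').2⟩) ρ'')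
    (x : ω.properPi1 r₀) : ρ'' x = ρ x * ρ' x := by
  obtain ⟨s, ⟨c, hc⟩, c', hc'⟩ :=
    ((eventually_exists_isLocalRule C.2).and (eventually_exists_isLocalRule C'.2)).exists
  have hcc' : IsLocalRule 𝔄 (C * C').1 s fun e w => c e w * c' e w :=
    fun e he b => congrArg₂ (· * ·) (hc e he b) (hc' e he b)
  obtain ⟨β, hβ, -⟩ := exists_basing ω (by omega : r₀ < r₀ + s + 1) 0
  have hs : s < β.idx.r := by omega
  obtain ⟨ζ, hζ⟩ := exists_represents β x
  rw [← ((isResidue_iff hc hs).mp h).value_eq hζ, ← ((isResidue_iff hc' hs).mp h').value_eq hζ,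
    ← ((isResidue_iff hcc' hs).mp h'').value_eq hζ, Trail.value_mul]

variable (ω r₀) in
theorem exists_residueHom : ∃ res : cocycleGroup 𝔄 G →* ω.properPi1 r₀ →* G,
    ∀ C : cocycleGroup 𝔄 G,
      IsResidue ω (Quotient.mk (cohomSetoid 𝔄 G) ⟨C.1, C.2⟩) (fun x => res C x) := by
  choose ρ hρ using fun C : cocycleGroup 𝔄 G =>
    exists_isResidue ω r₀ (Quotient.mk (cohomSetoid 𝔄 G) ⟨C.1, C.2⟩)
  exact ⟨MonoidHom.mk' (fun C => MonoidHom.mk' (ρ C) (hρ C).map_mul) fun C C' =>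
    MonoidHom.ext fun x => (hρ C).mul (hρ C') (hρ (C * C')) x, hρ⟩

variable (ω r₀) in
theorem existsUnique_residueHom : ∃! res : H1Group 𝔄 G →* ω.properPi1 r₀ →* G,
    ∀ C : cocycleGroup 𝔄 G,
      IsResidue ω (Quotient.mk (cohomSetoid 𝔄 G) ⟨C.1, C.2⟩)
        (fun x => res (QuotientGroup.mk C) x) := by
  obtain ⟨res, hres⟩ := exists_residueHom ω r₀ (G := G)
  refine ⟨QuotientGroup.lift _ res fun C hC => MonoidHom.ext fun x =>
    (hres C).eq_one_of_mem_trivialCocycles hC x, hres, fun res' hres' => ?_⟩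
  refine QuotientGroup.monoidHom_ext _ (MonoidHom.ext fun C => ?_)
  exact MonoidHom.ext (congrFun ((hres C).eq (hres' C)))

end CommGroup

end Residues

end CrystalDefect

open CrystalDefect ProperBaseRay in
theorem theorem2p6_general {D : ℕ} {A : Type*} [TopologicalSpace A] [CompactSpace A] [T2Space A]
    {𝔄 : Subshift A (Lat D)} {a : Lat D → A} (r₀ : ℕ) {Y : Set (Lat D)}
    (ω : ProperBaseRay 𝔄 a Y) :
    (∀ R, r₀ < R → ∃ β : ω.Basing r₀, β.idx.r = R) ∧
    (∀ (β : ω.Basing r₀) (x : ω.properPi1 r₀), ∃ ζ : Trail β.y β.y, Represents β ζ x) ∧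
    (∀ (G : Type*) [Group G] [TopologicalSpace G] [DiscreteTopology G],
      (∀ C ∈ cocycles 𝔄 G, ∃ s c, IsLocalRule 𝔄 C s c) ∧
      (∀ κ : H1 𝔄 G, ∃ ρ : ω.properPi1 r₀ → G, IsResidue ω κ ρ ∧
        ∀ ρ' : ω.properPi1 r₀ → G, IsResidue ω κ ρ' → ∃ g : G, ∀ x, ρ' x = g * ρ x * g⁻¹) ∧
      (∀ (κ : H1 𝔄 G) (ρ : ω.properPi1 r₀ → G), IsResidue ω κ ρ → (∃ x, ρ x ≠ 1) →
        IsEssential 𝔄 a ∧ Nontrivial (ω.properPi1 r₀))) ∧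
    (∀ (G : Type*) [CommGroup G] [TopologicalSpace G] [DiscreteTopology G],
      ∃! res : H1Group 𝔄 G →* ω.properPi1 r₀ →* G, ∀ C : cocycleGroup 𝔄 G,
        IsResidue ω (Quotient.mk (cohomSetoid 𝔄 G) ⟨C.1, C.2⟩)
          (fun x => res (QuotientGroup.mk C) x)) := by
  refine ⟨fun R hR => ?_, exists_represents, fun G _ _ _ => ⟨fun C hC => ?_, fun κ => ?_, ?_⟩,
    fun G _ _ _ => existsUnique_residueHom ω r₀⟩
  · obtain ⟨β, hβ, -⟩ := exists_basing ω hR 0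
    exact ⟨β, hβ⟩
  · exact (eventually_exists_isLocalRule hC).exists
  · obtain ⟨ρ, hρ⟩ := exists_isResidue ω r₀ κ
    exact ⟨ρ, hρ, fun ρ' => hρ.unique⟩
  · rintro κ ρ hρ ⟨x, hx⟩
    exact ⟨fun hremovable => hx (hρ.eq_one_of_isRemovable hremovable x),
      nontrivial_of_ne x 1 fun h => hx (h ▸ hρ.map_one)⟩

theorem theorem2p6 {D : ℕ} (hD : 1 ≤ D) {A : Type*} [Finite A] [TopologicalSpace A]
    [DiscreteTopology A] (𝔄 : Subshift A (CrystalDefect.Lat D)) (a : CrystalDefect.Lat D → A)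
    (ha : a ∈ CrystalDefect.slightlyDefective 𝔄)
    (r₀ : ℕ) (Y : Set (CrystalDefect.Lat D))
    (hY : CrystalDefect.IsProjectiveComponent 𝔄 a r₀ Y)
    (hYuniq : ∀ Y', CrystalDefect.IsProjectiveComponent 𝔄 a r₀ Y' → Y' = Y)
    (hcodim : CrystalDefect.HasProjectiveCodimTwo 𝔄 a r₀ Y)
    (ω : CrystalDefect.ProperBaseRay 𝔄 a Y) :
    -- representing trails exist at all ranges
    (∀ R, r₀ < R → ∃ β : ω.Basing r₀, β.idx.r = R) ∧
    (∀ (β : ω.Basing r₀) (x : ω.properPi1 r₀),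
      ∃ ζ : CrystalDefect.Trail β.y β.y, CrystalDefect.ProperBaseRay.Represents β ζ x) ∧
    -- arbitrary discrete coefficient groups
    (∀ (G : Type*) [Group G] [TopologicalSpace G] [DiscreteTopology G],
      -- every cocycle is locally determined
      (∀ C ∈ CrystalDefect.cocycles 𝔄 G, ∃ s c, CrystalDefect.IsLocalRule 𝔄 C s c) ∧
      -- the residue is well defined on cohomology classes, up to conjugation
      (∀ κ : CrystalDefect.H1 𝔄 G, ∃ ρ : ω.properPi1 r₀ → G,
        CrystalDefect.IsResidue ω κ ρ ∧
        ∀ ρ' : ω.properPi1 r₀ → G, CrystalDefect.IsResidue ω κ ρ' →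
          ∃ g : G, ∀ x, ρ' x = g * ρ x * g⁻¹) ∧
      -- a nontrivial residue forces an essential codimension-two defect
      (∀ (κ : CrystalDefect.H1 𝔄 G) (ρ : ω.properPi1 r₀ → G), CrystalDefect.IsResidue ω κ ρ →
        (∃ x, ρ x ≠ 1) →
        CrystalDefect.IsEssential 𝔄 a ∧ Nontrivial (ω.properPi1 r₀))) ∧
    -- abelian coefficients: the residue is a homomorphism in each variable
    (∀ (G : Type*) [CommGroup G] [TopologicalSpace G] [DiscreteTopology G],
      ∃! res : CrystalDefect.H1Group 𝔄 G →* ω.properPi1 r₀ →* G,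
        ∀ C : CrystalDefect.cocycleGroup 𝔄 G,
          CrystalDefect.IsResidue ω
            (Quotient.mk (CrystalDefect.cohomSetoid 𝔄 G) ⟨C.1, C.2⟩)
            (fun x => res (QuotientGroup.mk C) x)) :=
  theorem2p6_general r₀ ω
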